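/- Let $k$ be a field and let $\iota\colon N\to M$ be a homomorphism of unital $k$-algebras, $M\neq 0$, viewed as an extension $M|N$. Assume: (a) the centralizer of $N$ in $M$ is trivial: $R:=C_M(N)=k1_M$; (b) $M|N$ is biseparable: $M_N$ and ${}_NM$ are finitely generated projective, the multiplication $\mu\colon M\otimes_NM\to M$ is a split epimorphism of $M$-$M$-bimodules, and $N$ is isomorphic to a direct summand of $M$ as an $N$-$N$-bimodule; (c) $M|N$ has depth two: $M\otimes_NM$ is isomorphic to a direct summand of $M^n$ as an $N$-$M$-bimodule and to a direct summand of $M^m$ as an $M$-$N$-bimodule, for some positive integers $n,m$; (d) $M|N$ is Frobenius: there are an $N$-$N$-bimodule map $E\colon M\to N$ and $x_1,\dots,x_r,y_1,\dots,y_r\in M$ with $\sum_i x_iE(y_im)=m=\sum_iE(mx_i)y_i$ for all $m\in M$. Fix any such data. Let $A=\mathrm{End}({}_NM_N)$, an algebra under composition, and $B=(M\otimes_NM)^N=\{b\in M\otimes_N M: nb=bn\ \forall n\in N\}$, an algebra with product $bb'=b'^1b^1\otimes b^2b'^2$ and unit $1\otimes1$, where $b=b^1\otimes b^2$ denotes a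 possible sum of tensors. Let $M_1=M\otimes_NM$ with the product $(m\otimes m')(m''\otimes m''')=mE(m'm'')\otimes m'''$ and unit $\sum_i x_i\otimes y_i$; put $e_1=1\otimes 1\in M_1$ and $E_M=\mu\colon M_1\to M$. The map $m\mapsto\sum_i mx_i\otimes y_i$ makes $M_1|M$ a Frobenius extension with Frobenius homomorphism $E_M$ and dual bases $x_i\otimes 1$, $1\otimes y_i$. Applying the same construction to it gives $M_2=M_1\otimes_MM_1$, $e_2=1\otimes1\in M_2$ and $E_{M_1}\colon M_2\to M_1$. Let $\hat A=M_1^N$ be the centralizer of $N$ in $M_1$ and $\hat B=M_2^M$ the centralizer of $M$ in $M_2$. Call two Hopf algebras $H,K$ over $k$ dual via a bilinear form $p\colon H\times K\to k$ if $p$ is a perfect pairing for which the product, unit and antipode of each are the transposes of the coproduct, counit and antipode of the other, that is, $p(aa',b)=p(a,b_{(1)})p(a',b_{(2)})$, $p(a,bb')=p(a_{(1)},b)p(a_{(2)},b')$, $p(1,b)=\varepsilon(b)$, $p(a,1)=\varepsilon(a)$ and $p(S(a),b)=p(a,S(b))$. Then: 1. The algebra $A$ has a Hopf algebra structure with $\varepsilon_A(\alpha)=\alpha(1)$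 and $\Delta_A(\alpha)=\sum_i\gamma_i\otimes c_i^1\alpha(c_i^2\,\cdot\,)$ for all finite families $c_i\in B$, $\gamma_i\in A$ with $\sum_i\gamma_i(m)c_i^1\otimes c_i^2=1\otimes m$ for all $m\in M$. The algebra $B$ has a Hopf algebra structure with $\varepsilon_B(b)=b^1b^2$ and $\Delta_B(b)=\sum_ib_i\otimes(\beta_i(b^1)\otimes b^2)$ for all finite families $b_i\in B$, $\beta_i\in A$ with $\sum_ib_i^1\otimes b_i^2\beta_i(m)=m\otimes1$ for all $m\in M$. (Scalars in $k$ are identified with their images in $M$.) 2. $A$ and $B$ are finite dimensional over $k$ and semisimple, and they are dual Hopf algebras via $p(\alpha,b)=b^1\alpha(b^2)\in k1_M=k$. 3. The algebras $\hat A$ and $\hat B$ have Hopf algebra structures (those constructed by Kadison and Nikshych) that are dual via $p(a,b)=E_ME_{M_1}(a\,e_2e_1\,b)\in k1_M=k$; since this pairing is perfect, it determines both structures. 4. $A\cong\hat A$ and $B\cong\hat B$ as Hopf algebras. -/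

import Mathlib

open scoped TensorProduct

noncomputable section

namespace DepthTwo

universe u v w

/-! ### The tensor square of an algebra extension and its bimodule structure -/

section TensorSquare

variable {k : Type u} {N : Type v} {M : Type w} [CommRing k] [Ring N] [Ring M]
  [Algebra k N] [Algebra k M] (ι : N →ₐ[k] M)

/-- The relations `m n ⊗ m' = m ⊗ n m'` that turn `M ⊗[k] M` into `M ⊗_N M`. -/
def balancedRelations : Submodule k (M ⊗[k] M) :=
  Submodule.span k {t | ∃ (m : M) (n : N) (m' : M),
    t = (m * ι n) ⊗ₜ[k] m' - m ⊗ₜ[k] (ι n * m')}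

/-- The tensor square `M ⊗_N M` of an extension `ι : N → M` of `k`-algebras. -/
def TensorSq : Type w := (M ⊗[k] M) ⧸ balancedRelations ι

instance instAddCommGroupTensorSq : AddCommGroup (TensorSq ι) :=
  inferInstanceAs (AddCommGroup ((M ⊗[k] M) ⧸ balancedRelations ι))

instance instModuleTensorSq : Module k (TensorSq ι) :=
  inferInstanceAs (Module k ((M ⊗[k] M) ⧸ balancedRelations ι))

/-- The pure tensor `m ⊗ m'` in `M ⊗_N M`, as a `k`-bilinear map. -/
def tmul : M →ₗ[k] M →ₗ[k] TensorSq ι :=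
  (TensorProduct.mk k M M).compr₂ (balancedRelations ι).mkQ

variable {ι} in
theorem balancedRelations_le_ker {P : Type*} [AddCommGroup P] [Module k P]
    (f : M →ₗ[k] M →ₗ[k] P) (hf : ∀ (m : M) (n : N) (m' : M), f (m * ι n) m' = f m (ι n * m')) :
    balancedRelations ι ≤ LinearMap.ker (TensorProduct.lift f) := by
  refine Submodule.span_le.2 ?_
  rintro _ ⟨m, n, m', rfl⟩
  simp [hf]

variable {ι} in
/-- The universal property of `M ⊗_N M`. -/
def lift {P : Type*} [AddCommGroup P] [Module k P] (f : M →ₗ[k] M →ₗ[k] P)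
    (hf : ∀ (m : M) (n : N) (m' : M), f (m * ι n) m' = f m (ι n * m')) :
    TensorSq ι →ₗ[k] P :=
  (balancedRelations ι).liftQ (TensorProduct.lift f)
    (balancedRelations_le_ker f hf)

variable {ι} in
@[simp] theorem lift_tmul {P : Type*} [AddCommGroup P] [Module k P] (f : M →ₗ[k] M →ₗ[k] P)
    (hf : ∀ (m : M) (n : N) (m' : M), f (m * ι n) m' = f m (ι n * m')) (m m' : M) :
    lift f hf (tmul ι m m') = f m m' := by
  change (balancedRelations ι).liftQ (TensorProduct.lift f) _
    ((balancedRelations ι).mkQ (m ⊗ₜ m')) = _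
  rw [Submodule.mkQ_apply, Submodule.liftQ_apply, TensorProduct.lift.tmul]

theorem tmul_balanced (m : M) (n : N) (m' : M) :
    tmul ι (m * ι n) m' = tmul ι m (ι n * m') := by
  change (balancedRelations ι).mkQ _ = (balancedRelations ι).mkQ _
  rw [← sub_eq_zero, ← map_sub]
  exact (Submodule.Quotient.mk_eq_zero _).2 (Submodule.subset_span ⟨m, n, m', rfl⟩)

variable {ι} in
theorem induction {p : TensorSq ι → Prop} (h0 : p 0) (ht : ∀ m m', p (tmul ι m m'))
    (ha : ∀ s t, p s → p t → p (s + t)) (t : TensorSq ι) : p t := by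
  obtain ⟨t, rfl⟩ := (balancedRelations ι).mkQ_surjective t
  induction t using TensorProduct.induction_on with
  | zero => rw [map_zero]; exact h0
  | tmul m m' => exact ht m m'
  | add s t hs ht' => rw [map_add]; exact ha _ _ hs ht'

/-- The left action `m · (x ⊗ y) = m x ⊗ y`. -/
def lact (m : M) : TensorSq ι →ₗ[k] TensorSq ι :=
  lift ((tmul ι).comp (LinearMap.mulLeft k m)) (fun a n b => by
    simp only [LinearMap.comp_apply, LinearMap.mulLeft_apply]
    rw [← mul_assoc, tmul_balanced])

/-- The right action `(x ⊗ y) · m = x ⊗ y m`. -/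
def ract (m : M) : TensorSq ι →ₗ[k] TensorSq ι :=
  lift ((tmul ι).compl₂ (LinearMap.mulRight k m)) (fun a n b => by
    simp [mul_assoc, tmul_balanced])

@[simp] theorem lact_tmul (m a b : M) : lact ι m (tmul ι a b) = tmul ι (m * a) b := by
  simp [lact]

@[simp] theorem ract_tmul (m a b : M) : ract ι m (tmul ι a b) = tmul ι a (b * m) := by
  simp [ract]

theorem lact_add (m m' : M) (t : TensorSq ι) :
    lact ι (m + m') t = lact ι m t + lact ι m' t := by
  induction t using induction with
  | h0 => simp
  | ht a b => simp [add_mul]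
  | ha s t hs ht => simp only [map_add, hs, ht]; abel

theorem ract_add (m m' : M) (t : TensorSq ι) :
    ract ι (m + m') t = ract ι m t + ract ι m' t := by
  induction t using induction with
  | h0 => simp
  | ht a b => simp [mul_add]
  | ha s t hs ht => simp only [map_add, hs, ht]; abel

theorem lact_smul (c : k) (m : M) (t : TensorSq ι) :
    lact ι (c • m) t = c • lact ι m t := by
  induction t using induction with
  | h0 => simp
  | ht a b => simp
  | ha s t hs ht => simp only [map_add, hs, ht, smul_add]

theorem ract_smul (c : k) (m : M) (t : TensorSq ι) :
    ract ι (c • m) t = c • ract ι m t := by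
  induction t using induction with
  | h0 => simp
  | ht a b => simp
  | ha s t hs ht => simp only [map_add, hs, ht, smul_add]

theorem lact_mul (m m' : M) (t : TensorSq ι) :
    lact ι (m * m') t = lact ι m (lact ι m' t) := by
  induction t using induction with
  | h0 => simp
  | ht a b => simp [mul_assoc]
  | ha s t hs ht => simp only [map_add, hs, ht]

theorem ract_mul (m m' : M) (t : TensorSq ι) :
    ract ι (m * m') t = ract ι m' (ract ι m t) := by
  induction t using induction with
  | h0 => simp
  | ht a b => simp [mul_assoc]
  | ha s t hs ht => simp only [map_add, hs, ht]

theorem lact_one (t : TensorSq ι) : lact ι 1 t = t := by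
  induction t using induction with
  | h0 => simp
  | ht a b => simp
  | ha s t hs ht => simp only [map_add, hs, ht]

theorem ract_one (t : TensorSq ι) : ract ι 1 t = t := by
  induction t using induction with
  | h0 => simp
  | ht a b => simp
  | ha s t hs ht => simp only [map_add, hs, ht]

theorem lact_ract (m m' : M) (t : TensorSq ι) :
    lact ι m (ract ι m' t) = ract ι m' (lact ι m t) := by
  induction t using induction with
  | h0 => simp
  | ht a b => simp
  | ha s t hs ht => simp only [map_add, hs, ht]

/-- The multiplication `μ : M ⊗_N M → M`. -/
def mu : TensorSq ι →ₗ[k] M :=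
  lift (LinearMap.mul k M) (fun a n b => by simp [mul_assoc])

@[simp] theorem mu_tmul (a b : M) : mu ι (tmul ι a b) = a * b := by simp [mu]

theorem mu_lact (m : M) (t : TensorSq ι) : mu ι (lact ι m t) = m * mu ι t := by
  induction t using induction with
  | h0 => simp
  | ht a b => simp [mul_assoc]
  | ha s t hs ht => simp only [map_add, hs, ht, mul_add]

theorem mu_ract (m : M) (t : TensorSq ι) : mu ι (ract ι m t) = mu ι t * m := by
  induction t using induction with
  | h0 => simp
  | ht a b => simp [mul_assoc]
  | ha s t hs ht => simp only [map_add, hs, ht, add_mul]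

/-! ### The step two centralizers `A` and `B` -/

/-- `A = End(_N M_N)`, an algebra under composition. Additive `N`-`N`-bimodule endomorphisms are
automatically `k`-linear, because `k` acts through `N`. -/
def A : Subalgebra k (Module.End k M) where
  carrier := {f | ∀ (n : N) (m : M), f (ι n * m) = ι n * f m ∧ f (m * ι n) = f m * ι n}
  mul_mem' {f g} hf hg n m := by
    simp [(hg n m).1, (hg n m).2, (hf n (g m)).1, (hf n (g m)).2]
  add_mem' {f g} hf hg n m := by
    simp [(hg n m).1, (hg n m).2, (hf n m).1, (hf n m).2, mul_add, add_mul]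
  algebraMap_mem' c n m := by simp

/-- `B = (M ⊗_N M)^N`, the elements `b` of `M ⊗_N M` with `n b = b n` for all `n ∈ N`. -/
def B : Submodule k (TensorSq ι) where
  carrier := {t | ∀ n : N, lact ι (ι n) t = ract ι (ι n) t}
  add_mem' {s t} hs ht n := by rw [map_add, map_add, hs n, ht n]
  zero_mem' n := by simp
  smul_mem' c t ht n := by rw [map_smul, map_smul, ht n]

/-- For `b ∈ B`, the `M`-`M`-endomorphism `m ⊗ m' ↦ m b m' = m b¹ ⊗ b² m'` of `M ⊗_N M`. -/
def sandwich (b : B ι) : TensorSq ι →ₗ[k] TensorSq ι :=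
  lift (LinearMap.mk₂ k (fun m m' => lact ι m (ract ι m' b.1))
    (fun m₁ m₂ m' => lact_add ι m₁ m₂ _)
    (fun c m m' => lact_smul ι c m _)
    (fun m m₁ m₂ => by rw [ract_add, map_add])
    (fun c m m' => by rw [ract_smul, map_smul]))
  (fun m n m' => by
    simp only [LinearMap.mk₂_apply]
    rw [lact_mul, lact_ract ι (ι n), b.2 n, ract_mul])

@[simp] theorem sandwich_tmul (b : B ι) (m m' : M) :
    sandwich ι b (tmul ι m m') = lact ι m (ract ι m' b.1) := by
  simp [sandwich]

theorem sandwich_lact (b : B ι) (m : M) (t : TensorSq ι) :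
    sandwich ι b (lact ι m t) = lact ι m (sandwich ι b t) := by
  induction t using induction with
  | h0 => simp
  | ht a c => simp [lact_mul]
  | ha s t hs ht => simp only [map_add, hs, ht]

theorem sandwich_ract (b : B ι) (m : M) (t : TensorSq ι) :
    sandwich ι b (ract ι m t) = ract ι m (sandwich ι b t) := by
  induction t using induction with
  | h0 => simp
  | ht a c => simp [ract_mul, lact_ract]
  | ha s t hs ht => simp only [map_add, hs, ht]

/-- The multiplication of `B`: `b b' = b'¹ b¹ ⊗ b² b'²`. -/
instance instMulB : Mul (B ι) where
  mul b b' := ⟨sandwich ι b b'.1, fun n => by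
    rw [← sandwich_lact, ← sandwich_ract, b'.2 n]⟩

/-- The unit of `B` is `1 ⊗ 1`. -/
instance instOneB : One (B ι) where
  one := ⟨tmul ι 1 1, fun n => by
    have h := tmul_balanced ι 1 n 1
    simpa using h⟩

theorem coe_mul_B (b b' : B ι) : (b * b').1 = sandwich ι b b'.1 := rfl

theorem coe_one_B : (1 : B ι).1 = tmul ι 1 1 := rfl

theorem sandwich_add (b b' : B ι) (t : TensorSq ι) :
    sandwich ι (b + b') t = sandwich ι b t + sandwich ι b' t := by
  induction t using induction with
  | h0 => simp
  | ht a c => simp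
  | ha s t hs ht => simp only [map_add, hs, ht]; abel

theorem sandwich_smul (c : k) (b : B ι) (t : TensorSq ι) :
    sandwich ι (c • b) t = c • sandwich ι b t := by
  induction t using induction with
  | h0 => simp
  | ht a b => simp
  | ha s t hs ht => simp only [map_add, hs, ht, smul_add]

theorem sandwich_mul (b b' : B ι) (t : TensorSq ι) :
    sandwich ι (b * b') t = sandwich ι b (sandwich ι b' t) := by
  induction t using induction with
  | h0 => simp
  | ht a c => simp [coe_mul_B, sandwich_lact, sandwich_ract]
  | ha s t hs ht => simp only [map_add, hs, ht]

theorem sandwich_one (t : TensorSq ι) : sandwich ι 1 t = t := by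
  induction t using induction with
  | h0 => simp
  | ht a c => simp [coe_one_B]
  | ha s t hs ht => simp only [map_add, hs, ht]

instance instRingB : Ring (B ι) where
  __ : AddCommGroup (B ι) := inferInstance
  __ := instMulB ι
  __ := instOneB ι
  left_distrib a b c := Subtype.ext (map_add (sandwich ι a) b.1 c.1)
  right_distrib a b c := Subtype.ext (sandwich_add ι a b c.1)
  zero_mul a := Subtype.ext (by
    change sandwich ι 0 a.1 = 0
    have h := sandwich_smul ι 0 0 a.1
    simpa using h)
  mul_zero a := Subtype.ext (map_zero (sandwich ι a))
  mul_assoc a b c := Subtype.ext (sandwich_mul ι a b c.1)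
  one_mul a := Subtype.ext (sandwich_one ι a.1)
  mul_one a := Subtype.ext (by
    change sandwich ι a (tmul ι 1 1) = a.1
    rw [sandwich_tmul, ract_one, lact_one])

instance instAlgebraB : Algebra k (B ι) :=
  Algebra.ofModule (fun c a b => Subtype.ext (sandwich_smul ι c a b.1))
    (fun c a b => Subtype.ext (map_smul (sandwich ι a) c b.1))

/-- For `α ∈ A`, the map `α ⊗ id : x ⊗ y ↦ α(x) ⊗ y`. -/
def mapFst (α : A ι) : TensorSq ι →ₗ[k] TensorSq ι :=
  lift ((tmul ι).comp α.1) (fun m n m' => by simp [(α.2 n m).2, tmul_balanced])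

/-- For `α ∈ A`, the map `id ⊗ α : x ⊗ y ↦ x ⊗ α(y)`. -/
def mapSnd (α : A ι) : TensorSq ι →ₗ[k] TensorSq ι :=
  lift ((tmul ι).compl₂ α.1) (fun m n m' => by simp [(α.2 n m').1, tmul_balanced])

@[simp] theorem mapFst_tmul (α : A ι) (a b : M) :
    mapFst ι α (tmul ι a b) = tmul ι (α.1 a) b := by simp [mapFst]

@[simp] theorem mapSnd_tmul (α : A ι) (a b : M) :
    mapSnd ι α (tmul ι a b) = tmul ι a (α.1 b) := by simp [mapSnd]

/-- `α(b¹) ⊗ b² ∈ B`, for `α ∈ A` and `b ∈ B`. -/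
def applyFst (α : A ι) (b : B ι) : B ι :=
  ⟨mapFst ι α b.1, fun n => by
    have hl : ∀ t, mapFst ι α (lact ι (ι n) t) = lact ι (ι n) (mapFst ι α t) := fun t => by
      induction t using induction with
      | h0 => simp
      | ht a c => simp [(α.2 n a).1]
      | ha s t hs ht => simp only [map_add, hs, ht]
    have hr : ∀ t, mapFst ι α (ract ι (ι n) t) = ract ι (ι n) (mapFst ι α t) := fun t => by
      induction t using induction with
      | h0 => simp
      | ht a c => simp
      | ha s t hs ht => simp only [map_add, hs, ht]
    rw [← hl, ← hr, b.2 n]⟩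

/-- `m ↦ b¹ α(b² m)`, an element of `A`, for `α ∈ A` and `b ∈ B`. -/
def conjEnd (b : B ι) (α : A ι) : A ι :=
  ⟨{ toFun := fun m => mu ι (mapSnd ι α (ract ι m b.1))
     map_add' := fun m m' => by rw [ract_add, map_add, map_add]
     map_smul' := fun c m => by rw [ract_smul, map_smul, map_smul, RingHom.id_apply] },
   fun n m => by
    have hl : ∀ t, mapSnd ι α (lact ι (ι n) t) = lact ι (ι n) (mapSnd ι α t) := fun t => by
      induction t using induction with
      | h0 => simp
      | ht a c => simp
      | ha s t hs ht => simp only [map_add, hs, ht]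
    have hr : ∀ t, mapSnd ι α (ract ι (ι n) t) = ract ι (ι n) (mapSnd ι α t) := fun t => by
      induction t using induction with
      | h0 => simp
      | ht a c => simp [(α.2 n c).2]
      | ha s t hs ht => simp only [map_add, hs, ht]
    constructor
    · change mu ι (mapSnd ι α (ract ι (ι n * m) b.1)) = ι n * mu ι (mapSnd ι α (ract ι m b.1))
      rw [ract_mul, ← b.2 n, ← lact_ract, hl, mu_lact]
    · change mu ι (mapSnd ι α (ract ι (m * ι n) b.1)) = mu ι (mapSnd ι α (ract ι m b.1)) * ι n
      rw [ract_mul, hr, mu_ract]⟩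

@[simp] theorem conjEnd_apply (b : B ι) (α : A ι) (m : M) :
    (conjEnd ι b α).1 m = mu ι (mapSnd ι α (ract ι m b.1)) := rfl

/-- The canonical pairing `⟨b, α⟩ = b¹ α(b²)`; its values lie in the centralizer of `N` in `M`. -/
def pairing (α : A ι) (b : B ι) : M := mu ι (mapSnd ι α b.1)

/-! ### Classes of extensions -/

/-- `M|N` is left depth two: as an `N`-`M`-bimodule, `M ⊗_N M` is isomorphic to a direct summand
of `Mⁿ`, that is, a retract of it. -/
def IsLeftD2 : Prop :=
  ∃ n : ℕ, 0 < n ∧ ∃ (i : TensorSq ι →ₗ[k] (Fin n → M)) (p : (Fin n → M) →ₗ[k] TensorSq ι),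
    (∀ (a : N) t j, i (lact ι (ι a) t) j = ι a * i t j) ∧
    (∀ (m : M) t j, i (ract ι m t) j = i t j * m) ∧
    (∀ (a : N) f, p (fun j => ι a * f j) = lact ι (ι a) (p f)) ∧
    (∀ (m : M) f, p (fun j => f j * m) = ract ι m (p f)) ∧
    ∀ t, p (i t) = t

/-- `M|N` is right depth two: as an `M`-`N`-bimodule, `M ⊗_N M` is isomorphic to a direct summand
of `Mⁿ`. -/
def IsRightD2 : Prop :=
  ∃ n : ℕ, 0 < n ∧ ∃ (i : TensorSq ι →ₗ[k] (Fin n → M)) (p : (Fin n → M) →ₗ[k] TensorSq ι),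
    (∀ (m : M) t j, i (lact ι m t) j = m * i t j) ∧
    (∀ (a : N) t j, i (ract ι (ι a) t) j = i t j * ι a) ∧
    (∀ (m : M) f, p (fun j => m * f j) = lact ι m (p f)) ∧
    (∀ (a : N) f, p (fun j => f j * ι a) = ract ι (ι a) (p f)) ∧
    ∀ t, p (i t) = t

/-- Depth two: left and right depth two. -/
def IsDepthTwo : Prop := IsLeftD2 ι ∧ IsRightD2 ι

/-- `M|N` is separable: `μ : M ⊗_N M → M` is a split epimorphism of `M`-`M`-bimodules. -/
def IsSeparableExt : Prop :=
  ∃ σ : M →ₗ[k] TensorSq ι,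
    (∀ m x, σ (m * x) = lact ι m (σ x)) ∧ (∀ m x, σ (x * m) = ract ι m (σ x)) ∧
    ∀ x, mu ι (σ x) = x

/-- `M|N` is split: `N` is isomorphic to a direct summand of `M` as an `N`-`N`-bimodule. -/
def IsSplitExt : Prop :=
  ∃ (j : N →ₗ[k] M) (p : M →ₗ[k] N),
    (∀ a x, j (a * x) = ι a * j x) ∧ (∀ a x, j (x * a) = j x * ι a) ∧
    (∀ a m, p (ι a * m) = a * p m) ∧ (∀ a m, p (m * ι a) = p m * a) ∧
    ∀ x, p (j x) = x

/-- The left `N`-module `_N M`. -/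
@[reducible] def leftModule : Module N M := Module.compHom M ι.toRingHom

/-- The right `N`-module `M_N`. -/
@[reducible] def rightModule : Module Nᵐᵒᵖ M := Module.compHom M (RingHom.op ι.toRingHom)

/-- `M|N` is biseparable: split, separable, and finitely generated projective on both sides. -/
structure IsBiseparable : Prop where
  finite_left : @Module.Finite N M _ _ (leftModule ι)
  projective_left : @Module.Projective N _ M _ (leftModule ι)
  finite_right : @Module.Finite Nᵐᵒᵖ M _ _ (rightModule ι)
  projective_right : @Module.Projective Nᵐᵒᵖ _ M _ (rightModule ι)
  separable : IsSeparableExt ι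
  split : IsSplitExt ι

/-- A Frobenius homomorphism `E : M → N` with dual bases `x_i`, `y_i`. The extension `M|N` is
Frobenius if such data exist. -/
structure FrobeniusSystem where
  E : M →ₗ[k] N
  E_left : ∀ n m, E (ι n * m) = n * E m
  E_right : ∀ n m, E (m * ι n) = E m * n
  r : ℕ
  x : Fin r → M
  y : Fin r → M
  sum_left : ∀ m, ∑ i, x i * ι (E (y i * m)) = m
  sum_right : ∀ m, ∑ i, ι (E (m * x i)) * y i = m

/-- A left depth two quasibasis: `b_i ∈ B`, `β_i ∈ A` with `∑ b_i¹ ⊗ b_i² β_i(m) = m ⊗ 1`. -/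
structure LeftQuasibasis where
  r : ℕ
  b : Fin r → B ι
  β : Fin r → A ι
  sum_eq : ∀ m : M, ∑ i, ract ι ((β i).1 m) (b i).1 = tmul ι m 1

/-- A right depth two quasibasis: `c_i ∈ B`, `γ_i ∈ A` with `∑ γ_i(m) c_i¹ ⊗ c_i² = 1 ⊗ m`. -/
structure RightQuasibasis where
  r : ℕ
  c : Fin r → B ι
  γ : Fin r → A ι
  sum_eq : ∀ m : M, ∑ i, lact ι ((γ i).1 m) (c i).1 = tmul ι 1 m

end TensorSquare

/-! ### The basic construction and the Jones tower -/

namespace FrobeniusSystem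

variable {k : Type u} {N : Type v} {M : Type w} [CommRing k] [Ring N] [Ring M]
  [Algebra k N] [Algebra k M] {ι : N →ₐ[k] M} (F : FrobeniusSystem ι)

/-- The algebra `M₁ = M ⊗_N M` with the `E`-multiplication. -/
def Basic (_F : FrobeniusSystem ι) : Type w := TensorSq ι

instance instAddCommGroupBasic : AddCommGroup F.Basic := inferInstanceAs (AddCommGroup (TensorSq ι))

instance instModuleBasic : Module k F.Basic := inferInstanceAs (Module k (TensorSq ι))

/-- `m'' ⊗ m''' ↦ E(m' m'') m'''`. -/
def contract (m' : M) : TensorSq ι →ₗ[k] M :=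
  lift ((LinearMap.mul k M).comp (ι.toLinearMap.comp (F.E.comp (LinearMap.mulLeft k m'))))
    (fun a n b => by simp [← mul_assoc, F.E_right])

@[simp] theorem contract_tmul (m a b : M) :
    F.contract m (tmul ι a b) = ι (F.E (m * a)) * b := by simp [contract]

theorem contract_add (m m' : M) (t : TensorSq ι) :
    F.contract (m + m') t = F.contract m t + F.contract m' t := by
  induction t using induction with
  | h0 => simp
  | ht a b => simp [add_mul]
  | ha s t hs ht => simp only [map_add, hs, ht]; abel

theorem contract_smul (c : k) (m : M) (t : TensorSq ι) :
    F.contract (c • m) t = c • F.contract m t := by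
  induction t using induction with
  | h0 => simp
  | ht a b => simp
  | ha s t hs ht => simp only [map_add, hs, ht, smul_add]

theorem contract_mul (n : N) (m : M) (t : TensorSq ι) :
    F.contract (ι n * m) t = ι n * F.contract m t := by
  induction t using induction with
  | h0 => simp
  | ht a b => simp [mul_assoc, F.E_left]
  | ha s t hs ht => simp only [map_add, hs, ht, mul_add]

/-- The `E`-multiplication `(m ⊗ m')(m'' ⊗ m''') = m E(m' m'') ⊗ m'''`, where `E(m' m'') ∈ N` may
be moved across the tensor sign. -/
def mulAux : TensorSq ι →ₗ[k] TensorSq ι →ₗ[k] TensorSq ι :=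
  lift (LinearMap.mk₂ k (fun m m' => (tmul ι m).comp (F.contract m'))
    (fun m₁ m₂ m' => by ext t; simp)
    (fun c m m' => by ext t; simp)
    (fun m m₁ m₂ => by ext t; simp [contract_add])
    (fun c m m' => by ext t; simp [contract_smul]))
  (fun m n m' => by ext t; simp [contract_mul, tmul_balanced])

@[simp] theorem mulAux_tmul (m m' : M) (t : TensorSq ι) :
    F.mulAux (tmul ι m m') t = tmul ι m (F.contract m' t) := by
  simp [mulAux]

theorem mulAux_tmul_tmul (a b c d : M) :
    F.mulAux (tmul ι a b) (tmul ι c d) = tmul ι (a * ι (F.E (b * c))) d := by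
  simp [tmul_balanced]

/-- The unit `∑ x_i ⊗ y_i`. -/
def oneAux : TensorSq ι := ∑ i, tmul ι (F.x i) (F.y i)

theorem one_mulAux (t : TensorSq ι) : F.mulAux F.oneAux t = t := by
  induction t using induction with
  | h0 => simp
  | ht a b =>
    simp only [oneAux, map_sum, LinearMap.sum_apply, mulAux_tmul_tmul]
    rw [← LinearMap.sum_apply, ← map_sum, F.sum_left]
  | ha s t hs ht => simp only [map_add, hs, ht]

theorem mulAux_one (t : TensorSq ι) : F.mulAux t F.oneAux = t := by
  induction t using induction with
  | h0 => simp
  | ht a b =>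
    simp only [oneAux, map_sum, mulAux_tmul, contract_tmul]
    rw [← map_sum, F.sum_right]
  | ha s t hs ht => simp only [map_add, LinearMap.add_apply, hs, ht]

theorem contract_mulAux (m : M) (s t : TensorSq ι) :
    F.contract m (F.mulAux s t) = F.contract (F.contract m s) t := by
  induction s using induction with
  | h0 =>
    have h := F.contract_smul 0 0 t
    simp only [smul_zero, zero_smul] at h
    simp [h]
  | ht a b => simp [contract_mul]
  | ha s s' hs hs' => simp only [map_add, LinearMap.add_apply, hs, hs', contract_add]

theorem mulAux_assoc (s t u : TensorSq ι) :
    F.mulAux (F.mulAux s t) u = F.mulAux s (F.mulAux t u) := by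
  induction s using induction with
  | h0 => simp
  | ht a b => simp [contract_mulAux]
  | ha s s' hs hs' => simp only [map_add, LinearMap.add_apply, hs, hs']

instance instRingBasic : Ring F.Basic where
  __ := instAddCommGroupBasic F
  mul s t := F.mulAux s t
  one := F.oneAux
  left_distrib a b c := map_add (F.mulAux a) b c
  right_distrib a b c := LinearMap.map_add₂ F.mulAux a b c
  zero_mul a := LinearMap.map_zero₂ F.mulAux a
  mul_zero a := map_zero (F.mulAux a)
  mul_assoc := F.mulAux_assoc
  one_mul := F.one_mulAux
  mul_one := F.mulAux_one

instance instAlgebraBasic : Algebra k F.Basic :=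
  Algebra.ofModule (fun c a b => LinearMap.map_smul₂ F.mulAux c a b)
    (fun c a b => map_smul (F.mulAux a) c b)

theorem mulAux_lact (m : M) (s t : TensorSq ι) :
    F.mulAux (lact ι m s) t = lact ι m (F.mulAux s t) := by
  induction s using induction with
  | h0 => simp
  | ht a b => simp
  | ha s s' hs hs' => simp only [map_add, LinearMap.add_apply, hs, hs']

theorem mulAux_ract (m : M) (s t : TensorSq ι) :
    F.mulAux s (ract ι m t) = ract ι m (F.mulAux s t) := by
  have h : ∀ b, F.contract b (ract ι m t) = F.contract b t * m := fun b => by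
    induction t using induction with
    | h0 => simp
    | ht c d => simp [mul_assoc]
    | ha s t hs ht => simp only [map_add, hs, ht, add_mul]
  induction s using induction with
  | h0 => simp
  | ht a b => simp [h]
  | ha s s' hs hs' => simp only [map_add, LinearMap.add_apply, hs, hs']

theorem lact_oneAux (m : M) : lact ι m F.oneAux = ract ι m F.oneAux := by
  have h : lact ι m F.oneAux = F.mulAux F.oneAux (lact ι m F.oneAux) := (F.one_mulAux _).symm
  rw [h]
  simp only [oneAux, lact_tmul, map_sum, LinearMap.sum_apply, mulAux_tmul, contract_tmul,
    ract_tmul, ← mul_assoc]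
  rw [Finset.sum_comm]
  refine Finset.sum_congr rfl fun i _ => ?_
  rw [← map_sum, F.sum_right]

/-- The identification of the `k`-modules `M ⊗_N M` and `M₁`. -/
def toBasic : TensorSq ι ≃ₗ[k] F.Basic where
  toFun t := t
  invFun t := t
  map_add' _ _ := rfl
  map_smul' _ _ := rfl
  left_inv _ := rfl
  right_inv _ := rfl

theorem toBasic_mul (s t : TensorSq ι) :
    F.toBasic s * F.toBasic t = F.toBasic (F.mulAux s t) := rfl

theorem toBasic_one : F.toBasic F.oneAux = 1 := rfl

/-- The inclusion `M → M₁`, `m ↦ m · 1 = ∑ m x_i ⊗ y_i`. -/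
def incl : M →ₐ[k] F.Basic :=
  AlgHom.ofLinearMap
    { toFun := fun m => F.toBasic (lact ι m F.oneAux)
      map_add' := fun m m' => by rw [lact_add, map_add]
      map_smul' := fun c m => by rw [lact_smul, map_smul, RingHom.id_apply] }
    (by
      change F.toBasic (lact ι 1 F.oneAux) = 1
      rw [lact_one, toBasic_one])
    (fun m m' => by
      change F.toBasic (lact ι (m * m') F.oneAux) =
        F.toBasic (lact ι m F.oneAux) * F.toBasic (lact ι m' F.oneAux)
      rw [toBasic_mul, lact_mul, mulAux_lact, one_mulAux])

theorem incl_apply (m : M) : F.incl m = F.toBasic (lact ι m F.oneAux) := rfl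

theorem incl_mul (m : M) (t : TensorSq ι) :
    F.incl m * F.toBasic t = F.toBasic (lact ι m t) := by
  rw [incl_apply, toBasic_mul, mulAux_lact, one_mulAux]

theorem mul_incl (m : M) (t : TensorSq ι) :
    F.toBasic t * F.incl m = F.toBasic (ract ι m t) := by
  rw [incl_apply, toBasic_mul, lact_oneAux, mulAux_ract, mulAux_one]

/-- The element `1 ⊗ 1` of `M₁`, which is `e₁` for `M₁` and `e₂` for `M₂`. -/
def jones : F.Basic := F.toBasic (tmul ι 1 1)

/-- The Frobenius homomorphism `E_M = μ : M₁ → M`. -/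
def muBasic : F.Basic →ₗ[k] M := (mu ι).comp F.toBasic.symm.toLinearMap

theorem muBasic_toBasic (t : TensorSq ι) : F.muBasic (F.toBasic t) = mu ι t := rfl

/-- The Frobenius system of `M₁|M`: Frobenius homomorphism `E_M = μ`, dual bases `x_i ⊗ 1`,
`1 ⊗ y_i`. -/
def next : FrobeniusSystem F.incl where
  E := F.muBasic
  E_left m t := by
    obtain ⟨t, rfl⟩ := F.toBasic.surjective t
    rw [incl_mul, muBasic_toBasic, muBasic_toBasic, mu_lact]
  E_right m t := by
    obtain ⟨t, rfl⟩ := F.toBasic.surjective t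
    rw [mul_incl, muBasic_toBasic, muBasic_toBasic, mu_ract]
  r := F.r
  x i := F.toBasic (tmul ι (F.x i) 1)
  y i := F.toBasic (tmul ι 1 (F.y i))
  sum_left t := by
    obtain ⟨t, rfl⟩ := F.toBasic.surjective t
    simp only [toBasic_mul, muBasic_toBasic, mul_incl, ← map_sum]
    congr 1
    induction t using induction with
    | h0 => simp
    | ht a b =>
      simp only [mulAux_tmul, contract_tmul, mu_tmul, ract_tmul, one_mul]
      simp only [← tmul_balanced]
      rw [← LinearMap.sum_apply, ← map_sum, F.sum_left]
    | ha s t hs ht =>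
      simp only [map_add, ract_add, Finset.sum_add_distrib]
      rw [hs, ht]
  sum_right t := by
    obtain ⟨t, rfl⟩ := F.toBasic.surjective t
    simp only [toBasic_mul, muBasic_toBasic, incl_mul, ← map_sum]
    congr 1
    induction t using induction with
    | h0 => simp
    | ht a b =>
      simp only [mulAux_tmul, contract_tmul, mu_tmul, lact_tmul, mul_one]
      simp only [tmul_balanced]
      rw [← map_sum, F.sum_right]
    | ha s t hs ht =>
      simp only [map_add, LinearMap.add_apply, lact_add, Finset.sum_add_distrib]
      rw [hs, ht]

/-- `Â = M₁^N`, the centralizer of `N` in `M₁`. -/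
def Ahat : Subalgebra k F.Basic :=
  Subalgebra.centralizer k (Set.range fun n : N => F.incl (ι n))

/-- `B̂ = M₂^M`, the centralizer of `M` in `M₂ = M₁ ⊗_M M₁`. -/
def Bhat : Subalgebra k F.next.Basic :=
  Subalgebra.centralizer k (Set.range fun m : M => F.next.incl (F.incl m))

/-- The pairing `⟨a, b⟩ = E_M (E_{M₁} (a e₂ e₁ b))` of `Â` and `B̂`; its values lie in the
centralizer of `N` in `M`. -/
def towerPairing (a : F.Ahat) (b : F.Bhat) : M :=
  F.next.E (F.next.next.E (F.next.incl a.1 * F.next.jones * F.next.incl F.jones * b.1))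

end FrobeniusSystem

/-! ### Hopf algebra structures on a given algebra, and duality -/

section Hopf

variable (k : Type u) [CommRing k]

/-- A Hopf algebra structure on a given `k`-algebra `H`. -/
structure HopfStructure (H : Type w) [Ring H] [Algebra k H] extends Coalgebra k H where
  counit_one : counit 1 = 1
  counit_mul : ∀ a b, counit (a * b) = counit a * counit b
  comul_one : comul 1 = 1
  comul_mul : ∀ a b, comul (a * b) = comul a * comul b
  antipode : H →ₗ[k] H
  mul_antipode_rTensor_comul :
    LinearMap.mul' k H ∘ₗ antipode.rTensor H ∘ₗ comul = Algebra.linearMap k H ∘ₗ counit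
  mul_antipode_lTensor_comul :
    LinearMap.mul' k H ∘ₗ antipode.lTensor H ∘ₗ comul = Algebra.linearMap k H ∘ₗ counit

variable {k}

/-- The resulting Hopf algebra. -/
@[reducible] def HopfStructure.toHopfAlgebra {H : Type w} [Ring H] [Algebra k H]
    (S : HopfStructure k H) : HopfAlgebra k H :=
  letI := S.toCoalgebra
  letI : Bialgebra k H := Bialgebra.mk' k H S.counit_one (S.counit_mul _ _) S.comul_one
    (S.comul_mul _ _)
  { antipode := S.antipode
    mul_antipode_rTensor_comul := S.mul_antipode_rTensor_comul
    mul_antipode_lTensor_comul := S.mul_antipode_lTensor_comul }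

variable {H : Type v} {K : Type w} [Ring H] [Algebra k H] [Ring K] [Algebra k K]

/-- Two Hopf algebras are isomorphic: there is a bialgebra isomorphism that commutes with the
antipodes. -/
def HopfStructure.Isomorphic (S : HopfStructure k H) (T : HopfStructure k K) : Prop :=
  letI := S.toCoalgebra
  letI := T.toCoalgebra
  ∃ e : H ≃ₐc[k] K, ∀ a, e (S.antipode a) = T.antipode (e a)

/-- Two Hopf algebras are dual to one another by means of the bilinear form `p`: the form is a
perfect pairing, and it makes the product, unit and antipode of each one the transpose of the
coproduct, counit and antipode of the other one. -/
structure IsDualPairing (S : HopfStructure k H) (T : HopfStructure k K)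
    (p : H →ₗ[k] K →ₗ[k] k) : Prop where
  perfect : p.IsPerfPair
  mul_left : ∀ a a' b,
    p (a * a') b = LinearMap.mul' k k (TensorProduct.map (p a) (p a') (T.comul b))
  mul_right : ∀ a b b',
    p a (b * b') = LinearMap.mul' k k (TensorProduct.map (p.flip b) (p.flip b') (S.comul a))
  one_left : ∀ b, p 1 b = T.counit b
  one_right : ∀ a, p a 1 = S.counit a
  antipode : ∀ a b, p (S.antipode a) b = p a (T.antipode b)

end Hopf

section Statement

variable {k : Type u} {N : Type v} {M : Type w} [CommRing k] [Ring N] [Ring M]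
  [Algebra k N] [Algebra k M] {ι : N →ₐ[k] M}

/-- The coalgebra structure of `A`, for trivial centralizer `R = k`:
`Δ(α) = ∑ γ_i ⊗ c_i¹ α(c_i² -)` for right depth two quasibases, `ε(α) = α(1)`. -/
structure IsCanonicalA (S : HopfStructure k (A ι)) : Prop where
  comul_eq : ∀ (Q : RightQuasibasis ι) (α : A ι),
    S.comul α = ∑ i, Q.γ i ⊗ₜ[k] conjEnd ι (Q.c i) α
  counit_eq : ∀ α : A ι, algebraMap k M (S.counit α) = α.1 1

/-- The coalgebra structure of `B`, for trivial centralizer `R = k`: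
`Δ(b) = ∑ b_i ⊗ (β_i(b¹) ⊗ b²)` for left depth two quasibases, `ε(b) = b¹ b²`. -/
structure IsCanonicalB (S : HopfStructure k (B ι)) : Prop where
  comul_eq : ∀ (Q : LeftQuasibasis ι) (b : B ι),
    S.comul b = ∑ i, Q.b i ⊗ₜ[k] applyFst ι (Q.β i) b
  counit_eq : ∀ b : B ι, algebraMap k M (S.counit b) = mu ι b.1

/-- `S` and `T` are dual Hopf algebra structures on `A` and `B` by means of the canonical
pairing `⟨b, α⟩ = b¹ α(b²)`, which takes values in `R = k`. -/
def AreDual (S : HopfStructure k (A ι)) (T : HopfStructure k (B ι)) : Prop :=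
  ∃ p : A ι →ₗ[k] B ι →ₗ[k] k,
    (∀ α b, algebraMap k M (p α b) = pairing ι α b) ∧ IsDualPairing S T p

/-- `S` and `T` are the Hopf algebra structures on `Â = M₁^N` and `B̂ = M₂^M` that are dual to
one another by means of the pairing `⟨a, b⟩ = E_M E_{M₁} (a e₂ e₁ b)`, which takes values in
`R = k`. Since the pairing is perfect, it determines `S` and `T`. -/
def AreTowerHopf {F : FrobeniusSystem ι} (S : HopfStructure k F.Ahat)
    (T : HopfStructure k F.Bhat) : Prop :=
  ∃ p : F.Ahat →ₗ[k] F.Bhat →ₗ[k] k,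
    (∀ a b, algebraMap k M (p a b) = F.towerPairing a b) ∧ IsDualPairing S T p

end Statement

end DepthTwo

end

/-!
Write `⟨α, b⟩ = b¹ α(b²)` for `α ∈ A` and `b ∈ B`. Such an element commutes with the image of `N`,
so that it is a scalar when the centralizer is trivial. The depth two quasibases, which are the
components of the maps that split `M ⊗_N M` off `Mⁿ`, then become dual bases for this pairing:
`∑ ⟨α, cᵢ⟩ γᵢ = α` and `∑ ⟨γᵢ, b⟩ cᵢ = b`. Hence `A` and `B` are finite dimensional and the pairing
is perfect (`ScalarPart.isPerfPair_form`). The two comultiplications are the transposes of the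
products (`ScalarPart.isComulFor_A`, `ScalarPart.isComulFor_B`), which makes them coassociative and
independent of the quasibases. That `Δ` is multiplicative on `A` holds because `Δ(α)` is the only
element of `A ⊗ A` with `α₁(m) α₂(m') = α(m m')` (`ScalarPart.ext_of_evalMul`); on `B` it follows by
transposition (`IsComulFor.comul_mul`). The antipodes are defined by
`⟨S(α), b⟩ = α(b¹) b² = ⟨α, S(b)⟩`.

The Frobenius homomorphism `E` is a left integral of `A`, with `ε(E) ≠ 0` because `M|N` is split.
The `M`-central elements of `M ⊗_N M` are the multiples of `e = ∑ xᵢ ⊗ yᵢ`, and `μ(e) ≠ 0` because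
`M|N` is separable; comparing values of `μ` gives `∑ xᵢ d¹ ⊗ d² yᵢ = ε(d) e` for `d ∈ B`
(`FrobeniusSystem.sandwich_oneAux`), so `e` is a left integral of `B`. Maschke's argument shows that
both algebras are semisimple.

Finally `M₁` acts on `M` as `End(M_N)`, which identifies `Â` with `A`, and the same construction one
step higher identifies `B̂` with the algebra of `M`-`M`-endomorphisms of `M ⊗_N M`, that is, with
`B`. In these terms the tower pairing of `α` and `d` is `∑ E(xⱼ d¹) α(d²) yⱼ`. The identity for
`e`, applied to `d¹ ⊗ α(d²)`, shows that this is `d¹ α(d²)`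
(`FrobeniusSystem.towerPairing_eq`). So the Hopf structures on `Â` and `B̂` are those of `A` and
`B`, transported along the two isomorphisms.
-/

open scoped TensorProduct

noncomputable section

namespace DepthTwo

universe u v w x

/-! ### Dual Hopf structures from a non-degenerate pairing -/

section EvalTensor

variable {k V W U : Type*} [Field k] [AddCommGroup V] [Module k V] [AddCommGroup W] [Module k W]
  [AddCommGroup U] [Module k U]

/-- The functional `v ⊗ w ↦ f(v) g(w)`. -/
def evalTensor (f : V →ₗ[k] k) (g : W →ₗ[k] k) : V ⊗[k] W →ₗ[k] k :=
  LinearMap.mul' k k ∘ₗ TensorProduct.map f g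

@[simp] theorem evalTensor_tmul (f : V →ₗ[k] k) (g : W →ₗ[k] k) (v : V) (w : W) :
    evalTensor f g (v ⊗ₜ w) = f v * g w := by
  simp [evalTensor]

/-- Over a field, the products of two separating families of functionals separate the points of
the tensor product. -/
theorem eq_zero_of_evalTensor {I J : Type*} {φ : I → V →ₗ[k] k} {ψ : J → W →ₗ[k] k}
    (hφ : ∀ v, (∀ i, φ i v = 0) → v = 0) (hψ : ∀ w, (∀ j, ψ j w = 0) → w = 0)
    (t : V ⊗[k] W) (ht : ∀ i j, evalTensor (φ i) (ψ j) t = 0) : t = 0 := by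
  classical
  let b := Module.Basis.ofVectorSpace k V
  -- write `t = ∑ b_a ⊗ c_a`; each `ψ j` kills every `c_a`, since the `φ i` separate points of `V`
  obtain ⟨c, rfl⟩ := (TensorProduct.equivFinsuppOfBasisLeft (N := W) b).symm.surjective t
  have hc : c = 0 := by
    ext a
    refine hψ _ fun j => ?_
    have h1 : ∑ a ∈ c.support, ψ j (c a) • b a = 0 := hφ _ fun i => by
      have := ht i j
      rw [TensorProduct.equivFinsuppOfBasisLeft_symm_apply, Finsupp.sum, map_sum] at this
      simpa [mul_comm] using this
    by_cases ha : a ∈ c.support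
    · exact linearIndependent_iff'.1 b.linearIndependent _ _ h1 a ha
    · rw [Finsupp.notMem_support_iff.1 ha, map_zero]
  rw [hc, map_zero]

theorem ext_of_evalTensor {I J : Type*} {φ : I → V →ₗ[k] k} {ψ : J → W →ₗ[k] k}
    (hφ : ∀ v, (∀ i, φ i v = 0) → v = 0) (hψ : ∀ w, (∀ j, ψ j w = 0) → w = 0)
    {s t : V ⊗[k] W} (h : ∀ i j, evalTensor (φ i) (ψ j) s = evalTensor (φ i) (ψ j) t) :
    s = t :=
  sub_eq_zero.1 <| eq_zero_of_evalTensor hφ hψ _ fun i j => by rw [map_sub, h, sub_self]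

theorem evalTensor_lTensor {W' : Type*} [AddCommGroup W'] [Module k W'] (f : V →ₗ[k] k)
    (g : W' →ₗ[k] k) (h : W →ₗ[k] W') (t : V ⊗[k] W) :
    evalTensor f g (h.lTensor V t) = evalTensor f (g ∘ₗ h) t := by
  induction t with
  | zero => simp
  | tmul v w => simp
  | add s t hs ht => simp only [map_add, hs, ht]

theorem evalTensor_rTensor {V' : Type*} [AddCommGroup V'] [Module k V'] (f : V' →ₗ[k] k)
    (g : W →ₗ[k] k) (h : V →ₗ[k] V') (t : V ⊗[k] W) :
    evalTensor f g (h.rTensor W t) = evalTensor (f ∘ₗ h) g t := by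
  induction t with
  | zero => simp
  | tmul v w => simp
  | add s t hs ht => simp only [map_add, hs, ht]

theorem evalTensor_assoc (f : V →ₗ[k] k) (g : W →ₗ[k] k) (h : U →ₗ[k] k)
    (t : (V ⊗[k] W) ⊗[k] U) :
    evalTensor f (evalTensor g h) (TensorProduct.assoc k V W U t) =
      evalTensor (evalTensor f g) h t := by
  induction t with
  | zero => simp
  | tmul s u =>
    induction s with
    | zero => simp
    | tmul v w => simp [mul_assoc]
    | add s t hs ht => simp only [TensorProduct.add_tmul, map_add, hs, ht]
  | add s t hs ht => simp only [map_add, hs, ht]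

end EvalTensor

section Pairing

variable {k H K : Type*} [Field k] [Ring H] [Algebra k H] [Ring K] [Algebra k K]
  {p : H →ₗ[k] K →ₗ[k] k}

/-- A linear map `Δ : H → H ⊗ H` is the transpose of the product of `K`. -/
def IsComulFor (p : H →ₗ[k] K →ₗ[k] k) (Δ : H →ₗ[k] H ⊗[k] H) : Prop :=
  ∀ a b b', p a (b * b') = evalTensor (p.flip b) (p.flip b') (Δ a)

/-- A transpose of the product of `K` along a pairing without left kernel is a coalgebra structure,
whose counit is the transpose of the unit. -/
@[reducible] def coalgebraOfPairing (hp : ∀ a, (∀ b, p a b = 0) → a = 0)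
    (Δ : H →ₗ[k] H ⊗[k] H) (hΔ : IsComulFor p Δ) : Coalgebra k H where
  comul := Δ
  counit := p.flip 1
  coassoc := by
    ext a
    refine ext_of_evalTensor (φ := p.flip)
      (ψ := fun b : K × K => evalTensor (p.flip b.1) (p.flip b.2)) hp
      (fun t ht => eq_zero_of_evalTensor hp hp t fun i j => ht (i, j)) fun b ⟨b', b''⟩ => ?_
    have h (b b') : evalTensor (p.flip b) (p.flip b') ∘ₗ Δ = p.flip (b * b') :=
      LinearMap.ext fun a => (hΔ a b b').symm
    simp only [LinearMap.comp_apply, LinearEquiv.coe_coe]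
    rw [evalTensor_assoc, evalTensor_rTensor, evalTensor_lTensor, h, h, ← hΔ, ← hΔ, mul_assoc]
  rTensor_counit_comp_comul := by
    ext a
    refine ext_of_evalTensor (φ := fun _ : Unit => LinearMap.id) (ψ := p.flip)
      (fun v hv => hv ()) hp fun _ b => ?_
    simp only [LinearMap.comp_apply]
    rw [evalTensor_rTensor, LinearMap.id_comp, ← hΔ]
    simp
  lTensor_counit_comp_comul := by
    ext a
    refine ext_of_evalTensor (φ := p.flip) (ψ := fun _ : Unit => LinearMap.id)
      hp (fun v hv => hv ()) fun b _ => ?_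
    simp only [LinearMap.comp_apply]
    rw [evalTensor_lTensor, LinearMap.id_comp, ← hΔ]
    simp

/-- If `Δ_H` and `Δ_K` are transposes of the products, then `Δ_K` is multiplicative as soon as
`Δ_H` is: both sides pair with `a ⊗ a'` to the pairing of `Δ_H(a) Δ_H(a')` with `b ⊗ b'`. -/
theorem IsComulFor.comul_mul {ΔH : H →ₗ[k] H ⊗[k] H} {ΔK : K →ₗ[k] K ⊗[k] K}
    (hH : IsComulFor p ΔH) (hK : IsComulFor p.flip ΔK) (hp : ∀ b, (∀ a, p a b = 0) → b = 0)
    (hmul : ∀ a a', ΔH (a * a') = ΔH a * ΔH a') (b b' : K) :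
    ΔK (b * b') = ΔK b * ΔK b' := by
  refine ext_of_evalTensor (φ := p) (ψ := p) hp hp fun a a' => ?_
  have h1 := hK (b * b') a a'
  simp only [LinearMap.flip_flip, LinearMap.flip_apply] at h1
  rw [← h1, hH, hmul]
  obtain ⟨r, u, v, hu⟩ := TensorProduct.exists_sum_tmul_eq (ΔH a)
  obtain ⟨r', u', v', hu'⟩ := TensorProduct.exists_sum_tmul_eq (ΔH a')
  -- the product of `K ⊗ K` is the transpose of `Δ_H ⊗ Δ_H`, up to the middle exchange
  have key : ∀ X Y : K ⊗[k] K, evalTensor (p a) (p a') (X * Y) =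
      ∑ i, ∑ j, evalTensor (p (u i)) (p (u' j)) X * evalTensor (p (v i)) (p (v' j)) Y := by
    intro X Y
    induction X with
    | zero => simp
    | add s t hs ht => simp only [add_mul, map_add, hs, ht, Finset.sum_add_distrib]
    | tmul x x' =>
      induction Y with
      | zero => simp
      | add s t hs ht => simp only [mul_add, map_add, hs, ht, Finset.sum_add_distrib]
      | tmul y y' =>
        rw [Algebra.TensorProduct.tmul_mul_tmul, evalTensor_tmul, hH, hH, hu, hu']
        simp only [map_sum, evalTensor_tmul, LinearMap.flip_apply, Finset.sum_mul_sum]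
        exact Finset.sum_congr rfl fun i _ => Finset.sum_congr rfl fun j _ => by ring
  rw [key, hu, hu', Finset.sum_mul_sum, map_sum]
  refine Finset.sum_congr rfl fun i _ => ?_
  rw [map_sum]
  refine Finset.sum_congr rfl fun j _ => ?_
  have h2 := hK b (u i) (u' j)
  have h3 := hK b' (v i) (v' j)
  simp only [LinearMap.flip_flip, LinearMap.flip_apply] at h2 h3
  rw [← h2, ← h3, Algebra.TensorProduct.tmul_mul_tmul, evalTensor_tmul]
  rfl

/-- The product of `K` is the transpose of `Δ_H`, for an arbitrary element of `K ⊗ K`. -/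
theorem IsComulFor.pair_mul' {ΔH : H →ₗ[k] H ⊗[k] H} (hH : IsComulFor p ΔH) (a : H) {r : ℕ}
    {u v : Fin r → H} (hu : ΔH a = ∑ i, u i ⊗ₜ v i) (t : K ⊗[k] K) :
    p a (LinearMap.mul' k K t) = ∑ i, evalTensor (p (u i)) (p (v i)) t := by
  induction t with
  | zero => simp
  | tmul x y => simp [hH a x y, hu]
  | add s t hs ht => simp only [map_add, hs, ht, Finset.sum_add_distrib]

/-- The transpose of a left convolution inverse of the identity of `H` is one for `K`. -/
theorem IsComulFor.antipode_rTensor {ΔH : H →ₗ[k] H ⊗[k] H} {ΔK : K →ₗ[k] K ⊗[k] K}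
    (hH : IsComulFor p ΔH) (hK : IsComulFor p.flip ΔK) (hp : ∀ b, (∀ a, p a b = 0) → b = 0)
    {SH : H →ₗ[k] H} {SK : K →ₗ[k] K} (hS : ∀ a b, p (SH a) b = p a (SK b))
    (h : LinearMap.mul' k H ∘ₗ SH.rTensor H ∘ₗ ΔH = Algebra.linearMap k H ∘ₗ p.flip 1) :
    LinearMap.mul' k K ∘ₗ SK.rTensor K ∘ₗ ΔK = Algebra.linearMap k K ∘ₗ p 1 := by
  ext b
  rw [← sub_eq_zero]
  refine hp _ fun a => ?_
  obtain ⟨r, u, v, hu⟩ := TensorProduct.exists_sum_tmul_eq (ΔH a)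
  have h0 := LinearMap.congr_fun h a
  simp only [LinearMap.comp_apply, hu, map_sum, LinearMap.rTensor_tmul, LinearMap.mul'_apply,
    Algebra.linearMap_apply, Algebra.algebraMap_eq_smul_one, LinearMap.flip_apply] at h0
  have hSK : ∀ a, p a ∘ₗ SK = p (SH a) := fun a => LinearMap.ext fun b => (hS a b).symm
  have h2 := fun a a' => hK b a a'
  simp only [LinearMap.flip_flip, LinearMap.flip_apply] at h2
  simp only [LinearMap.comp_apply, map_sub]
  rw [hH.pair_mul' a hu]
  simp only [evalTensor_rTensor, hSK, ← h2]
  rw [← LinearMap.sum_apply, ← map_sum, h0, Algebra.linearMap_apply,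
    Algebra.algebraMap_eq_smul_one]
  simp [mul_comm]

/-- The transpose of a right convolution inverse of the identity of `H` is one for `K`. -/
theorem IsComulFor.antipode_lTensor {ΔH : H →ₗ[k] H ⊗[k] H} {ΔK : K →ₗ[k] K ⊗[k] K}
    (hH : IsComulFor p ΔH) (hK : IsComulFor p.flip ΔK) (hp : ∀ b, (∀ a, p a b = 0) → b = 0)
    {SH : H →ₗ[k] H} {SK : K →ₗ[k] K} (hS : ∀ a b, p (SH a) b = p a (SK b))
    (h : LinearMap.mul' k H ∘ₗ SH.lTensor H ∘ₗ ΔH = Algebra.linearMap k H ∘ₗ p.flip 1) :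
    LinearMap.mul' k K ∘ₗ SK.lTensor K ∘ₗ ΔK = Algebra.linearMap k K ∘ₗ p 1 := by
  ext b
  rw [← sub_eq_zero]
  refine hp _ fun a => ?_
  obtain ⟨r, u, v, hu⟩ := TensorProduct.exists_sum_tmul_eq (ΔH a)
  have h0 := LinearMap.congr_fun h a
  simp only [LinearMap.comp_apply, hu, map_sum, LinearMap.lTensor_tmul, LinearMap.mul'_apply,
    Algebra.linearMap_apply, Algebra.algebraMap_eq_smul_one, LinearMap.flip_apply] at h0
  have hSK : ∀ a, p a ∘ₗ SK = p (SH a) := fun a => LinearMap.ext fun b => (hS a b).symm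
  have h2 := fun a a' => hK b a a'
  simp only [LinearMap.flip_flip, LinearMap.flip_apply] at h2
  simp only [LinearMap.comp_apply, map_sub]
  rw [hH.pair_mul' a hu]
  simp only [evalTensor_lTensor, hSK, ← h2]
  rw [← LinearMap.sum_apply, ← map_sum, h0, Algebra.linearMap_apply,
    Algebra.algebraMap_eq_smul_one]
  simp [mul_comm]

end Pairing

/-! ### Transport of Hopf structures along algebra isomorphisms -/

section Transport

variable {k : Type u} [Field k]

/-- The coalgebra structure transported along a linear isomorphism. -/
@[reducible] def transportCoalgebra {V : Type v} {W : Type w} [AddCommGroup V] [Module k V]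
    [AddCommGroup W] [Module k W] (S : Coalgebra k V) (e : V ≃ₗ[k] W) : Coalgebra k W where
  comul := TensorProduct.map e.toLinearMap e.toLinearMap ∘ₗ S.comul ∘ₗ e.symm.toLinearMap
  counit := S.counit ∘ₗ e.symm.toLinearMap
  coassoc := by
    have h1 : ∀ t : V ⊗[k] V, TensorProduct.assoc k W W W
        ((TensorProduct.map e.toLinearMap e.toLinearMap ∘ₗ S.comul ∘ₗ e.symm.toLinearMap).rTensor W
          (TensorProduct.map e.toLinearMap e.toLinearMap t)) =
        TensorProduct.map e.toLinearMap (TensorProduct.map e.toLinearMap e.toLinearMap)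
          (TensorProduct.assoc k V V V (S.comul.rTensor V t)) := fun t => by
      induction t with
      | zero => simp
      | add s t hs ht => simp only [map_add, hs, ht]
      | tmul x y =>
        simp only [TensorProduct.map_tmul, LinearMap.rTensor_tmul, LinearMap.comp_apply,
          LinearEquiv.coe_coe, LinearEquiv.symm_apply_apply]
        induction S.comul x with
        | zero => simp
        | add s t hs ht => simp only [map_add, TensorProduct.add_tmul, hs, ht]
        | tmul z w => simp
    have h2 : ∀ t : V ⊗[k] V,
        (TensorProduct.map e.toLinearMap e.toLinearMap ∘ₗ S.comul ∘ₗ e.symm.toLinearMap).lTensor W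
          (TensorProduct.map e.toLinearMap e.toLinearMap t) =
        TensorProduct.map e.toLinearMap (TensorProduct.map e.toLinearMap e.toLinearMap)
          (S.comul.lTensor V t) := fun t => by
      induction t with
      | zero => simp
      | add s t hs ht => simp only [map_add, hs, ht]
      | tmul x y => simp
    refine LinearMap.ext fun w => ?_
    have h3 := LinearMap.congr_fun S.coassoc (e.symm w)
    simp only [LinearMap.comp_apply, LinearEquiv.coe_coe] at h1 h2 h3 ⊢
    rw [h1, h2, h3]
  rTensor_counit_comp_comul := by
    refine LinearMap.ext fun w => ?_
    have h1 : ∀ t : V ⊗[k] V, (S.counit ∘ₗ e.symm.toLinearMap).rTensor W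
        (TensorProduct.map e.toLinearMap e.toLinearMap t) =
        e.toLinearMap.lTensor k (S.counit.rTensor V t) := fun t => by
      induction t with
      | zero => simp
      | add s t hs ht => simp only [map_add, hs, ht]
      | tmul x y => simp
    have h3 := LinearMap.congr_fun S.rTensor_counit_comp_comul (e.symm w)
    simp only [LinearMap.comp_apply, LinearEquiv.coe_coe] at h1 h3 ⊢
    rw [h1, h3]
    simp
  lTensor_counit_comp_comul := by
    refine LinearMap.ext fun w => ?_
    have h1 : ∀ t : V ⊗[k] V, (S.counit ∘ₗ e.symm.toLinearMap).lTensor W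
        (TensorProduct.map e.toLinearMap e.toLinearMap t) =
        e.toLinearMap.rTensor k (S.counit.lTensor V t) := fun t => by
      induction t with
      | zero => simp
      | add s t hs ht => simp only [map_add, hs, ht]
      | tmul x y => simp
    have h3 := LinearMap.congr_fun S.lTensor_counit_comp_comul (e.symm w)
    simp only [LinearMap.comp_apply, LinearEquiv.coe_coe] at h1 h3 ⊢
    rw [h1, h3]
    simp

variable {H : Type v} {H' : Type w} [Ring H] [Algebra k H] [Ring H'] [Algebra k H']

theorem mul'_map_algEquiv (e : H ≃ₐ[k] H') (t : H ⊗[k] H) :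
    LinearMap.mul' k H' (TensorProduct.map e.toLinearMap e.toLinearMap t) =
      e (LinearMap.mul' k H t) := by
  induction t with
  | zero => simp
  | add s t hs ht => simp only [map_add, hs, ht]
  | tmul x y => simp

/-- The Hopf algebra structure transported along an algebra isomorphism. -/
def HopfStructure.transport (S : HopfStructure k H) (e : H ≃ₐ[k] H') : HopfStructure k H' where
  toCoalgebra := transportCoalgebra S.toCoalgebra e.toLinearEquiv
  counit_one := by
    change S.counit (e.symm 1) = 1
    rw [map_one, S.counit_one]
  counit_mul a b := by
    change S.counit (e.symm (a * b)) = S.counit (e.symm a) * S.counit (e.symm b)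
    rw [map_mul, S.counit_mul]
  comul_one := by
    change Algebra.TensorProduct.map e.toAlgHom e.toAlgHom (S.comul (e.symm 1)) = 1
    rw [map_one, S.comul_one, map_one]
  comul_mul a b := by
    change Algebra.TensorProduct.map e.toAlgHom e.toAlgHom (S.comul (e.symm (a * b))) =
      Algebra.TensorProduct.map e.toAlgHom e.toAlgHom (S.comul (e.symm a)) *
      Algebra.TensorProduct.map e.toAlgHom e.toAlgHom (S.comul (e.symm b))
    rw [map_mul, S.comul_mul, map_mul]
  antipode := e.toLinearMap ∘ₗ S.antipode ∘ₗ e.symm.toLinearMap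
  mul_antipode_rTensor_comul := by
    refine LinearMap.ext fun a => ?_
    have h : ∀ t : H ⊗[k] H, (e.toLinearMap ∘ₗ S.antipode ∘ₗ e.symm.toLinearMap).rTensor H'
        (TensorProduct.map e.toLinearMap e.toLinearMap t) =
        TensorProduct.map e.toLinearMap e.toLinearMap (S.antipode.rTensor H t) := fun t => by
      induction t with
      | zero => simp
      | add s t hs ht => simp only [map_add, hs, ht]
      | tmul x y => simp
    change LinearMap.mul' k H' ((e.toLinearMap ∘ₗ S.antipode ∘ₗ e.symm.toLinearMap).rTensor H'
      (TensorProduct.map e.toLinearMap e.toLinearMap (S.comul (e.symm a)))) =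
      algebraMap k H' (S.counit (e.symm a))
    have h3 := LinearMap.congr_fun S.mul_antipode_rTensor_comul (e.symm a)
    simp only [LinearMap.comp_apply] at h3
    rw [h, mul'_map_algEquiv, h3]
    simp
  mul_antipode_lTensor_comul := by
    refine LinearMap.ext fun a => ?_
    have h : ∀ t : H ⊗[k] H, (e.toLinearMap ∘ₗ S.antipode ∘ₗ e.symm.toLinearMap).lTensor H'
        (TensorProduct.map e.toLinearMap e.toLinearMap t) =
        TensorProduct.map e.toLinearMap e.toLinearMap (S.antipode.lTensor H t) := fun t => by
      induction t with
      | zero => simp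
      | add s t hs ht => simp only [map_add, hs, ht]
      | tmul x y => simp
    change LinearMap.mul' k H' ((e.toLinearMap ∘ₗ S.antipode ∘ₗ e.symm.toLinearMap).lTensor H'
      (TensorProduct.map e.toLinearMap e.toLinearMap (S.comul (e.symm a)))) =
      algebraMap k H' (S.counit (e.symm a))
    have h3 := LinearMap.congr_fun S.mul_antipode_lTensor_comul (e.symm a)
    simp only [LinearMap.comp_apply] at h3
    rw [h, mul'_map_algEquiv, h3]
    simp

theorem HopfStructure.isomorphic_transport (S : HopfStructure k H) (e : H ≃ₐ[k] H') :
    S.Isomorphic (S.transport e) := by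
  let := S.toCoalgebra
  let := (S.transport e).toCoalgebra
  refine ⟨{ e with
    map_smul' := map_smul e
    counit_comp := LinearMap.ext fun a => ?_
    map_comp_comul := LinearMap.ext fun a => ?_ }, fun a => ?_⟩
  · exact congrArg S.counit (e.symm_apply_apply a)
  · change _ = TensorProduct.map e.toLinearMap e.toLinearMap (S.comul (e.symm (e a)))
    rw [e.symm_apply_apply]
    rfl
  · change e (S.antipode a) = e (S.antipode (e.symm (e a)))
    rw [e.symm_apply_apply]

theorem IsDualPairing.transport {K : Type x} {K' : Type*} [Ring K] [Algebra k K] [Ring K']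
    [Algebra k K'] {S : HopfStructure k H} {T : HopfStructure k K} {p : H →ₗ[k] K →ₗ[k] k}
    (h : IsDualPairing S T p) (e : H ≃ₐ[k] H') (f : K ≃ₐ[k] K') :
    IsDualPairing (S.transport e) (T.transport f)
      (p.compl₁₂ e.symm.toLinearMap f.symm.toLinearMap) where
  perfect := by
    have := h.perfect
    exact LinearMap.IsPerfPair.compl₁₂ p e.symm.toLinearEquiv f.symm.toLinearEquiv
  mul_left a a' b := by
    have key : ∀ t : K ⊗[k] K, LinearMap.mul' k k (TensorProduct.map
        (p.compl₁₂ e.symm.toLinearMap f.symm.toLinearMap a)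
        (p.compl₁₂ e.symm.toLinearMap f.symm.toLinearMap a')
        (TensorProduct.map f.toLinearMap f.toLinearMap t)) =
        LinearMap.mul' k k (TensorProduct.map (p (e.symm a)) (p (e.symm a')) t) := fun t => by
      induction t with
      | zero => simp
      | add s t hs ht => simp only [map_add, hs, ht]
      | tmul x y => simp
    have h1 := h.mul_left (e.symm a) (e.symm a') (f.symm b)
    rw [← map_mul, ← key] at h1
    exact h1
  mul_right a b b' := by
    have key : ∀ t : H ⊗[k] H, LinearMap.mul' k k (TensorProduct.map
        ((p.compl₁₂ e.symm.toLinearMap f.symm.toLinearMap).flip b)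
        ((p.compl₁₂ e.symm.toLinearMap f.symm.toLinearMap).flip b')
        (TensorProduct.map e.toLinearMap e.toLinearMap t)) =
        LinearMap.mul' k k (TensorProduct.map (p.flip (f.symm b)) (p.flip (f.symm b')) t) :=
      fun t => by
        induction t with
        | zero => simp
        | add s t hs ht => simp only [map_add, hs, ht]
        | tmul x y => simp
    have h1 := h.mul_right (e.symm a) (f.symm b) (f.symm b')
    rw [← map_mul, ← key] at h1
    exact h1
  one_left b := by
    have h1 := h.one_left (f.symm b)
    rw [← map_one e.symm] at h1
    exact h1
  one_right a := by
    have h1 := h.one_right (e.symm a)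
    rw [← map_one f.symm] at h1
    exact h1
  antipode a b := by
    have h1 := h.antipode (e.symm a) (f.symm b)
    change p (e.symm (e (S.antipode (e.symm a)))) (f.symm b) =
      p (e.symm a) (f.symm (f (T.antipode (f.symm b))))
    rwa [e.symm_apply_apply, f.symm_apply_apply]

end Transport

/-! ### Semisimplicity of Hopf algebras with a normalized integral -/

section Maschke

variable {k H : Type*} [Field k] [Ring H] [Algebra k H]

/-- An algebra over a field with a separability element `∑ uᵢ ⊗ vᵢ` is semisimple: averaging with
the separability element turns a linear projection onto a left ideal into an `H`-linear one. -/
theorem isSemisimpleRing_of_separability_element {r : ℕ} (u v : Fin r → H)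
    (h1 : ∑ i, u i * v i = 1)
    (hc : ∀ a, ∑ i, (a * u i) ⊗ₜ[k] v i = ∑ i, u i ⊗ₜ[k] (v i * a)) : IsSemisimpleRing H := by
  refine { exists_isCompl := fun W => ?_ }
  obtain ⟨π, hπ⟩ := (W.restrictScalars k).subtype.exists_leftInverse_of_injective
    (by simp)
  let P : H →ₗ[k] H := (W.restrictScalars k).subtype ∘ₗ π
  have hPW : ∀ x, P x ∈ W := fun x => (π x).2
  have hP : ∀ w ∈ W, P w = w := fun w hw =>
    congrArg Subtype.val (LinearMap.congr_fun hπ ⟨w, hw⟩)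
  let f : H →ₗ[H] W := LinearMap.codRestrict W
    { toFun := fun x => ∑ i, u i * P (v i * x)
      map_add' := fun x y => by simp only [mul_add, map_add, Finset.sum_add_distrib]
      map_smul' := fun a x => by
        have h2 := congrArg
          (LinearMap.mul' k H ∘ₗ (P ∘ₗ LinearMap.mulRight k x).lTensor H) (hc a)
        simp only [map_sum, LinearMap.comp_apply, LinearMap.lTensor_tmul, LinearMap.mul'_apply,
          LinearMap.mulRight_apply] at h2
        simp only [smul_eq_mul, RingHom.id_apply, Finset.mul_sum, ← mul_assoc]
        exact h2.symm }
    (fun x => show ∑ i, u i * P (v i * x) ∈ W from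
      W.sum_mem fun i _ => W.smul_mem (u i) (hPW _))
  refine ⟨LinearMap.ker f, LinearMap.isCompl_of_proj fun w => Subtype.ext ?_⟩
  change ∑ i, u i * P (v i * w) = w
  have h4 : ∀ i, P (v i * w) = v i * w := fun i => hP _ (W.smul_mem (v i) w.2)
  simp only [h4, ← mul_assoc]
  rw [← Finset.sum_mul, h1, one_mul]

/-- A Hopf algebra with a left integral of counit `1` is semisimple. -/
theorem HopfStructure.isSemisimpleRing (S : HopfStructure k H) (Λ : H)
    (hΛ : ∀ a, a * Λ = S.counit a • Λ) (h1 : S.counit Λ = 1) : IsSemisimpleRing H := by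
  let := S.toHopfAlgebra
  have hΛ' : ∀ a, a * Λ = Coalgebra.counit (R := k) a • Λ := hΛ
  have h1' : Coalgebra.counit (R := k) Λ = 1 := h1
  obtain ⟨r, u, v, hu⟩ := TensorProduct.exists_sum_tmul_eq (Coalgebra.comul (R := k) Λ)
  refine isSemisimpleRing_of_separability_element (k := k) u
    (fun i => HopfAlgebra.antipode k (v i)) ?_ fun a => ?_
  · have := HopfAlgebra.mul_antipode_lTensor_comul_apply (R := k) Λ
    rw [hu, h1'] at this
    simpa using this
  · let Q : H ⊗[k] (H ⊗[k] H) →ₗ[k] H ⊗[k] H := ∑ l, TensorProduct.map (LinearMap.mulRight k (u l))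
      (LinearMap.mul' k H ∘ₗ
        (HopfAlgebra.antipode k ∘ₗ LinearMap.mulRight k (v l)).rTensor H)
    have hQ : ∀ c d y, Q (c ⊗ₜ (d ⊗ₜ y)) =
        ∑ l, (c * u l) ⊗ₜ (HopfAlgebra.antipode k (d * v l) * y) := fun c d y => by
      simp [Q]
    let ra := Coalgebra.Repr.arbitrary k a
    have hco := congrArg Q (Coalgebra.sum_tmul_tmul_eq ra
      (fun i => Coalgebra.Repr.arbitrary k (ra.left i))
      (fun i => Coalgebra.Repr.arbitrary k (ra.right i)))
    simp only [map_sum, hQ] at hco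
    -- `(a₁Λ)₁ ⊗ S((a₁Λ)₂) a₂ = Λ₁ ⊗ S(Λ₂) a`, because `Λ` is an integral
    have hleft : ∀ b y : H, ∑ j ∈ (Coalgebra.Repr.arbitrary k b).index, ∑ l,
        ((Coalgebra.Repr.arbitrary k b).left j * u l) ⊗ₜ[k]
          (HopfAlgebra.antipode k ((Coalgebra.Repr.arbitrary k b).right j * v l) * y) =
        Coalgebra.counit (R := k) b • ∑ l, u l ⊗ₜ (HopfAlgebra.antipode k (v l) * y) :=
      fun b y => by
        have h2 := congrArg
          ((LinearMap.mulRight k y ∘ₗ HopfAlgebra.antipode k).lTensor H)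
          (Bialgebra.comul_mul (R := k) b Λ)
        rw [hΛ', map_smul, hu, ← (Coalgebra.Repr.arbitrary k b).eq, Finset.sum_mul_sum] at h2
        simpa using h2.symm
    -- `a₁Λ₁ ⊗ S(a₂Λ₂) a₃ = a Λ₁ ⊗ S(Λ₂)`, because `S` is anti-multiplicative
    have hright : ∀ c b : H, ∑ j ∈ (Coalgebra.Repr.arbitrary k b).index, ∑ l,
        (c * u l) ⊗ₜ[k] (HopfAlgebra.antipode k ((Coalgebra.Repr.arbitrary k b).left j * v l) *
          (Coalgebra.Repr.arbitrary k b).right j) =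
        Coalgebra.counit (R := k) b • ∑ l, (c * u l) ⊗ₜ HopfAlgebra.antipode k (v l) :=
      fun c b => by
        rw [Finset.sum_comm, Finset.smul_sum]
        refine Finset.sum_congr rfl fun l _ => ?_
        rw [← TensorProduct.tmul_sum, ← TensorProduct.tmul_smul]
        simp only [HopfAlgebra.antipode_mul_antidistrib, mul_assoc]
        rw [← Finset.mul_sum, HopfAlgebra.sum_antipode_mul_eq_smul, mul_smul_comm, mul_one]
    simp only [hleft, hright] at hco
    simp only [Finset.smul_sum] at hco
    rw [Finset.sum_comm, Finset.sum_comm (s := ra.index)] at hco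
    simp only [← TensorProduct.tmul_smul, ← mul_smul_comm, ← TensorProduct.tmul_sum,
      ← Finset.mul_sum, Coalgebra.sum_counit_smul] at hco
    simp only [TensorProduct.tmul_smul, TensorProduct.smul_tmul', ← smul_mul_assoc,
      ← TensorProduct.sum_tmul, ← Finset.sum_mul] at hco
    have h5 : ∑ i ∈ ra.index, Coalgebra.counit (R := k) (ra.right i) • ra.left i = a := by
      have := congrArg (TensorProduct.rid k H) (Coalgebra.sum_tmul_counit_eq ra)
      simpa only [map_sum, TensorProduct.rid_tmul, one_smul] using this
    rw [h5] at hco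
    exact hco.symm

end Maschke

/-! ### Depth two quasibases -/

section Quasibases

variable {k : Type u} {N : Type v} {M : Type w} [CommRing k] [Ring N] [Ring M]
  [Algebra k N] [Algebra k M] {ι : N →ₐ[k] M}

theorem mapSnd_lact (α : A ι) (m : M) (t : TensorSq ι) :
    mapSnd ι α (lact ι m t) = lact ι m (mapSnd ι α t) := by
  induction t using induction with
  | h0 => simp
  | ht a b => simp
  | ha s t hs ht => simp only [map_add, hs, ht]

theorem mapSnd_ract_map (α : A ι) (n : N) (t : TensorSq ι) :
    mapSnd ι α (ract ι (ι n) t) = ract ι (ι n) (mapSnd ι α t) := by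
  induction t using induction with
  | h0 => simp
  | ht a b => simp [(α.2 n b).2]
  | ha s t hs ht => simp only [map_add, hs, ht]

theorem mapFst_mapSnd (α β : A ι) (t : TensorSq ι) :
    mapFst ι α (mapSnd ι β t) = mapSnd ι β (mapFst ι α t) := by
  induction t using induction with
  | h0 => simp
  | ht a b => simp
  | ha s t hs ht => simp only [map_add, hs, ht]

theorem mapFst_add (α β : A ι) (t : TensorSq ι) :
    mapFst ι (α + β) t = mapFst ι α t + mapFst ι β t := by
  induction t using induction with
  | h0 => simp
  | ht a b => simp
  | ha s t hs ht => simp only [map_add, hs, ht]; abel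

theorem mapSnd_add (α β : A ι) (t : TensorSq ι) :
    mapSnd ι (α + β) t = mapSnd ι α t + mapSnd ι β t := by
  induction t using induction with
  | h0 => simp
  | ht a b => simp
  | ha s t hs ht => simp only [map_add, hs, ht]; abel

theorem mapFst_smul (c : k) (α : A ι) (t : TensorSq ι) :
    mapFst ι (c • α) t = c • mapFst ι α t := by
  induction t using induction with
  | h0 => simp
  | ht a b => simp
  | ha s t hs ht => simp only [map_add, hs, ht, smul_add]

theorem mapSnd_smul (c : k) (α : A ι) (t : TensorSq ι) :
    mapSnd ι (c • α) t = c • mapSnd ι α t := by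
  induction t using induction with
  | h0 => simp
  | ht a b => simp
  | ha s t hs ht => simp only [map_add, hs, ht, smul_add]

theorem mapSnd_mul (α β : A ι) (t : TensorSq ι) :
    mapSnd ι (α * β) t = mapSnd ι α (mapSnd ι β t) := by
  induction t using induction with
  | h0 => simp
  | ht a b => simp
  | ha s t hs ht => simp only [map_add, hs, ht]

theorem mapSnd_one (t : TensorSq ι) : mapSnd ι 1 t = t := by
  induction t using induction with
  | h0 => simp
  | ht a b => simp
  | ha s t hs ht => simp only [map_add, hs, ht]

/-- `b¹ ⊗ α(b²) ∈ B`, for `α ∈ A` and `b ∈ B`. -/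
def applySnd (α : A ι) (b : B ι) : B ι :=
  ⟨mapSnd ι α b.1, fun n => by rw [← mapSnd_lact, ← mapSnd_ract_map, b.2 n]⟩

/-- `applyFst` as a bilinear map. -/
def applyFstₗ (ι : N →ₐ[k] M) : A ι →ₗ[k] B ι →ₗ[k] B ι :=
  LinearMap.mk₂ k (applyFst ι) (fun α β b => Subtype.ext (mapFst_add α β b.1))
    (fun c α b => Subtype.ext (mapFst_smul c α b.1))
    (fun α b b' => Subtype.ext (map_add (mapFst ι α) b.1 b'.1))
    (fun c α b => Subtype.ext (map_smul (mapFst ι α) c b.1))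

/-- `conjEnd` as a bilinear map. -/
def conjEndₗ (ι : N →ₐ[k] M) : B ι →ₗ[k] A ι →ₗ[k] A ι :=
  LinearMap.mk₂ k (conjEnd ι)
    (fun b b' α => Subtype.ext <| LinearMap.ext fun m => by
      change mu ι (mapSnd ι α (ract ι m (b.1 + b'.1))) = mu ι _ + mu ι _
      rw [map_add, map_add, map_add])
    (fun c b α => Subtype.ext <| LinearMap.ext fun m => by
      change mu ι (mapSnd ι α (ract ι m (c • b.1))) = c • mu ι _
      rw [map_smul, map_smul, map_smul])
    (fun b α β => Subtype.ext <| LinearMap.ext fun m => by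
      change mu ι (mapSnd ι (α + β) (ract ι m b.1)) = mu ι _ + mu ι _
      rw [mapSnd_add, map_add])
    (fun c b α => Subtype.ext <| LinearMap.ext fun m => by
      change mu ι (mapSnd ι (c • α) (ract ι m b.1)) = c • mu ι _
      rw [mapSnd_smul, map_smul])

theorem mu_commute (b : B ι) (n : N) : ι n * mu ι b.1 = mu ι b.1 * ι n := by
  rw [← mu_lact, b.2 n, mu_ract]

theorem pairing_mul_left (α β : A ι) (b : B ι) :
    pairing ι (α * β) b = pairing ι α (applySnd β b) :=
  congrArg (mu ι) (mapSnd_mul α β b.1)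

theorem pairing_mul_right (α : A ι) (b b' : B ι) :
    pairing ι α (b * b') = pairing ι (conjEnd ι b α) b' := by
  have h : ∀ t, mu ι (mapSnd ι α (sandwich ι b t)) = mu ι (mapSnd ι (conjEnd ι b α) t) := by
    intro t
    induction t using induction with
    | h0 => simp
    | ht m m' => rw [sandwich_tmul, mapSnd_lact, mu_lact, mapSnd_tmul, mu_tmul, conjEnd_apply]
    | ha s t hs ht => simp only [map_add, hs, ht]
  exact h b'.1

namespace RightQuasibasis

variable (Q : RightQuasibasis ι)

/-- `m ⊗ m' = ∑ m γᵢ(m') cᵢ`. -/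
theorem expand (t : TensorSq ι) :
    ∑ i, lact ι (mu ι (mapSnd ι (Q.γ i) t)) (Q.c i).1 = t := by
  induction t using induction with
  | h0 => simp [show ∀ t, lact ι (0 : M) t = 0 from fun t => by
      simpa using lact_smul ι (0 : k) (0 : M) t]
  | ht a b =>
    simp only [mapSnd_tmul, mu_tmul, lact_mul]
    rw [← map_sum, Q.sum_eq, lact_tmul, mul_one]
  | ha s t hs ht => simp only [map_add, lact_add, Finset.sum_add_distrib, hs, ht]

/-- `∑ γᵢ(m) cᵢ¹ α(cᵢ² m') = α(m m')`: in other words, `Δ(α)` records the action of `α`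
on products. -/
theorem sum_mul_conjEnd (α : A ι) (m m' : M) :
    ∑ i, (Q.γ i).1 m * (conjEnd ι (Q.c i) α).1 m' = α.1 (m * m') := by
  have h := congrArg (fun t => mu ι (mapSnd ι α (ract ι m' t))) (Q.sum_eq m)
  simp only [map_sum, ← lact_ract, mapSnd_lact, mu_lact, ract_tmul, mapSnd_tmul, mu_tmul,
    one_mul] at h
  exact h

end RightQuasibasis

namespace LeftQuasibasis

variable (Q : LeftQuasibasis ι)

/-- `m ⊗ m' = ∑ bᵢ βᵢ(m) m'`. -/
theorem expand (t : TensorSq ι) :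
    ∑ i, ract ι (mu ι (mapFst ι (Q.β i) t)) (Q.b i).1 = t := by
  induction t using induction with
  | h0 => simp [show ∀ t, ract ι (0 : M) t = 0 from fun t => by
      simpa using ract_smul ι (0 : k) (0 : M) t]
  | ht a b =>
    simp only [mapFst_tmul, mu_tmul, ract_mul]
    rw [← map_sum, Q.sum_eq, ract_tmul, one_mul]
  | ha s t hs ht => simp only [map_add, ract_add, Finset.sum_add_distrib, hs, ht]

/-- `∑ bᵢ¹ α(bᵢ² βᵢ(m)) = m α(1)`. -/
theorem sum_conjEnd (α : A ι) (m : M) :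
    ∑ i, (conjEnd ι (Q.b i) α).1 ((Q.β i).1 m) = m * α.1 1 := by
  have h := congrArg (fun t => mu ι (mapSnd ι α t)) (Q.sum_eq m)
  simpa using h

end LeftQuasibasis

/-- The components of the maps that exhibit `M ⊗_N M` as a retract of `Mⁿ` form a quasibasis. -/
theorem IsLeftD2.exists_quasibasis (h : IsLeftD2 ι) : Nonempty (LeftQuasibasis ι) := by
  obtain ⟨n, -, i, p, h1, h2, h3, h4, h5⟩ := h
  refine ⟨⟨n, fun j => ⟨p (Pi.single j 1), fun a => ?_⟩,
    fun j => ⟨LinearMap.proj j ∘ₗ i ∘ₗ (tmul ι).flip 1, fun a m => ⟨?_, ?_⟩⟩, fun m => ?_⟩⟩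
  · rw [← h3, ← h4]
    congr 1
    ext l
    by_cases hl : l = j
    · subst hl; simp
    · simp [hl]
  · have := h1 a (tmul ι m 1) j
    simpa using this
  · have := h2 (ι a) (tmul ι m 1) j
    rw [ract_tmul, one_mul] at this
    simp only [LinearMap.comp_apply, LinearMap.flip_apply, LinearMap.proj_apply, tmul_balanced,
      mul_one, this]
  · simp only [LinearMap.comp_apply, LinearMap.flip_apply, LinearMap.proj_apply, ← h4]
    rw [← map_sum, ← h5 (tmul ι m 1)]
    congr 1
    ext l
    simp [Finset.sum_apply, Pi.single_apply, h5]

theorem IsRightD2.exists_quasibasis (h : IsRightD2 ι) : Nonempty (RightQuasibasis ι) := by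
  obtain ⟨n, -, i, p, h1, h2, h3, h4, h5⟩ := h
  refine ⟨⟨n, fun j => ⟨p (Pi.single j 1), fun a => ?_⟩,
    fun j => ⟨LinearMap.proj j ∘ₗ i ∘ₗ tmul ι 1, fun a m => ⟨?_, ?_⟩⟩, fun m => ?_⟩⟩
  · rw [← h3, ← h4]
    congr 1
    ext l
    by_cases hl : l = j
    · subst hl; simp
    · simp [hl]
  · have := h1 (ι a) (tmul ι 1 m) j
    rw [lact_tmul, mul_one] at this
    simp only [LinearMap.comp_apply, LinearMap.proj_apply, ← tmul_balanced, one_mul, this]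
  · have := h2 a (tmul ι 1 m) j
    simpa using this
  · simp only [LinearMap.comp_apply, LinearMap.proj_apply, ← h3]
    rw [← map_sum, ← h5 (tmul ι 1 m)]
    congr 1
    ext l
    simp [Finset.sum_apply, Pi.single_apply, h5]

end Quasibases

/-! ### The canonical pairing over a trivial centralizer -/

section CanonicalPairing

variable {k : Type u} {N : Type v} {M : Type w} [Field k] [Ring N] [Ring M]
  [Algebra k N] [Algebra k M] {ι : N →ₐ[k] M}

/-- A linear map `M → k` that inverts `k → M` on the centralizer of `N`; it serves to turn
`k`-bilinear maps with values in the centralizer into bilinear forms. -/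
structure ScalarPart (ι : N →ₐ[k] M) where
  toFun : M →ₗ[k] k
  algebraMap_toFun : ∀ z, (∀ n, ι n * z = z * ι n) → algebraMap k M (toFun z) = z

theorem exists_scalarPart [Nontrivial M] (hR : Subalgebra.centralizer k (Set.range ι) = ⊥) :
    Nonempty (ScalarPart ι) := by
  obtain ⟨π, hπ⟩ := (Algebra.linearMap k M).exists_leftInverse_of_injective
    (LinearMap.ker_eq_bot.2 (algebraMap k M).injective)
  refine ⟨⟨π, fun z hz => ?_⟩⟩
  have hmem : z ∈ Subalgebra.centralizer k (Set.range ι) := by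
    rw [Subalgebra.mem_centralizer_iff]
    rintro _ ⟨n, rfl⟩
    exact hz n
  rw [hR, Algebra.mem_bot] at hmem
  obtain ⟨c, rfl⟩ := hmem
  exact congrArg (algebraMap k M) (LinearMap.congr_fun hπ c)

namespace ScalarPart

variable (π : ScalarPart ι)

/-- The bilinear form `⟨α, b⟩ = b¹ α(b²)` on `A × B`. -/
def form : A ι →ₗ[k] B ι →ₗ[k] k :=
  LinearMap.mk₂ k (fun α b => π.toFun (pairing ι α b))
    (fun α β b => by rw [pairing, mapSnd_add, map_add, map_add]; rfl)
    (fun c α b => by rw [pairing, mapSnd_smul, map_smul, map_smul]; rfl)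
    (fun α b b' => by
      rw [← map_add]; exact congrArg π.toFun (map_add (mu ι ∘ₗ mapSnd ι α) b.1 b'.1))
    (fun c α b => by
      rw [← map_smul]; exact congrArg π.toFun (map_smul (mu ι ∘ₗ mapSnd ι α) c b.1))

/-- The bilinear form `α(b¹) b²` on `A × B`. It differs from the canonical form by the antipode. -/
def twistedForm : A ι →ₗ[k] B ι →ₗ[k] k :=
  LinearMap.mk₂ k (fun α b => π.toFun (mu ι (mapFst ι α b.1)))
    (fun α β b => by rw [mapFst_add, map_add, map_add])
    (fun c α b => by rw [mapFst_smul, map_smul, map_smul])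
    (fun α b b' => by
      rw [← map_add]; exact congrArg π.toFun (map_add (mu ι ∘ₗ mapFst ι α) b.1 b'.1))
    (fun c α b => by
      rw [← map_smul]; exact congrArg π.toFun (map_smul (mu ι ∘ₗ mapFst ι α) c b.1))

theorem algebraMap_form (α : A ι) (b : B ι) : algebraMap k M (π.form α b) = pairing ι α b :=
  π.algebraMap_toFun _ (mu_commute (applySnd α b))

theorem algebraMap_twistedForm (α : A ι) (b : B ι) :
    algebraMap k M (π.twistedForm α b) = mu ι (mapFst ι α b.1) :=
  π.algebraMap_toFun _ (mu_commute (applyFst ι α b))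

theorem algebraMap_form_one (α : A ι) : algebraMap k M (π.form α 1) = α.1 1 := by
  rw [algebraMap_form]
  simp [pairing, coe_one_B]

theorem algebraMap_one_form (b : B ι) : algebraMap k M (π.form 1 b) = mu ι b.1 := by
  rw [algebraMap_form, pairing, mapSnd_one]

theorem lact_algebraMap (c : k) (t : TensorSq ι) : lact ι (algebraMap k M c) t = c • t := by
  rw [Algebra.algebraMap_eq_smul_one, lact_smul, lact_one]

theorem ract_algebraMap (c : k) (t : TensorSq ι) : ract ι (algebraMap k M c) t = c • t := by
  rw [Algebra.algebraMap_eq_smul_one, ract_smul, ract_one]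

/-- The `cᵢ` and `γᵢ` of a right quasibasis are dual bases for the canonical pairing; compare
`sum_form_smul_γ`. -/
theorem sum_form_smul_c (Q : RightQuasibasis ι) (b : B ι) :
    ∑ i, π.form (Q.γ i) b • Q.c i = b := by
  refine Subtype.ext ?_
  rw [AddSubmonoidClass.coe_finsetSum]
  refine Eq.trans (Finset.sum_congr rfl fun i _ => ?_) (Q.expand b.1)
  rw [← pairing, ← π.algebraMap_form, lact_algebraMap]
  rfl

theorem sum_twistedForm_smul_b (Q : LeftQuasibasis ι) (b : B ι) :
    ∑ i, π.twistedForm (Q.β i) b • Q.b i = b := by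
  refine Subtype.ext ?_
  rw [AddSubmonoidClass.coe_finsetSum]
  refine Eq.trans (Finset.sum_congr rfl fun i _ => ?_) (Q.expand b.1)
  rw [← π.algebraMap_twistedForm, ract_algebraMap]
  rfl

theorem sum_form_smul_γ (Q : RightQuasibasis ι) (α : A ι) :
    ∑ i, π.form α (Q.c i) • Q.γ i = α := by
  refine Subtype.ext <| LinearMap.ext fun m => ?_
  have h := congrArg (fun t => mu ι (mapSnd ι α t)) (Q.sum_eq m)
  simp only [map_sum, mapSnd_lact, mu_lact, mapSnd_tmul, mu_tmul, one_mul] at h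
  rw [← h, AddSubmonoidClass.coe_finsetSum, LinearMap.sum_apply]
  refine Finset.sum_congr rfl fun i _ => ?_
  rw [← pairing, ← π.algebraMap_form, ← Algebra.commutes, ← Algebra.smul_def]
  rfl

theorem form_left_separating (Q : RightQuasibasis ι) (α : A ι) (h : ∀ b, π.form α b = 0) :
    α = 0 := by
  rw [← π.sum_form_smul_γ Q α]
  simp [h]

theorem form_right_separating (Q : RightQuasibasis ι) (b : B ι) (h : ∀ α, π.form α b = 0) :
    b = 0 := by
  rw [← π.sum_form_smul_c Q b]
  simp [h]

theorem finite_A (π : ScalarPart ι) (Q : RightQuasibasis ι) : Module.Finite k (A ι) :=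
  Module.Finite.of_surjective (Fintype.linearCombination k Q.γ) fun α =>
    ⟨fun i => π.form α (Q.c i), π.sum_form_smul_γ Q α⟩

theorem finite_B (π : ScalarPart ι) (Q : RightQuasibasis ι) : Module.Finite k (B ι) :=
  Module.Finite.of_surjective (Fintype.linearCombination k Q.c) fun b =>
    ⟨fun i => π.form (Q.γ i) b, π.sum_form_smul_c Q b⟩

theorem isPerfPair_form (Q : RightQuasibasis ι) :
    LinearMap.IsPerfPair (R := k) (M := A ι) (N := B ι) π.form := by
  have := π.finite_A Q
  refine LinearMap.IsPerfPair.of_injective ?_ ?_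
  · refine (injective_iff_map_eq_zero _).2 fun α h => π.form_left_separating Q α fun b => ?_
    rw [h, LinearMap.zero_apply]
  · refine (injective_iff_map_eq_zero _).2 fun b h => π.form_right_separating Q b fun α => ?_
    exact LinearMap.congr_fun h α

end ScalarPart

end CanonicalPairing

/-! ### The Hopf algebra structures on `A` and `B` -/

section HopfAB

variable {k : Type u} {N : Type v} {M : Type w} [Field k] [Ring N] [Ring M]
  [Algebra k N] [Algebra k M] {ι : N →ₐ[k] M}

/-- The comultiplication `Δ(α) = ∑ γᵢ ⊗ cᵢ¹ α(cᵢ² -)` of `A`. -/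
def RightQuasibasis.comul (Q : RightQuasibasis ι) : A ι →ₗ[k] A ι ⊗[k] A ι :=
  ∑ i, TensorProduct.mk k (A ι) (A ι) (Q.γ i) ∘ₗ conjEndₗ ι (Q.c i)

theorem RightQuasibasis.comul_apply (Q : RightQuasibasis ι) (α : A ι) :
    Q.comul α = ∑ i, Q.γ i ⊗ₜ[k] conjEnd ι (Q.c i) α := by
  rw [RightQuasibasis.comul, LinearMap.sum_apply]
  rfl

/-- The comultiplication `Δ(b) = ∑ bᵢ ⊗ (βᵢ(b¹) ⊗ b²)` of `B`. -/
def LeftQuasibasis.comul (Q : LeftQuasibasis ι) : B ι →ₗ[k] B ι ⊗[k] B ι :=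
  ∑ i, TensorProduct.mk k (B ι) (B ι) (Q.b i) ∘ₗ applyFstₗ ι (Q.β i)

theorem LeftQuasibasis.comul_apply (Q : LeftQuasibasis ι) (b : B ι) :
    Q.comul b = ∑ i, Q.b i ⊗ₜ[k] applyFst ι (Q.β i) b := by
  rw [LeftQuasibasis.comul, LinearMap.sum_apply]
  rfl

/-- The map `α ⊗ α' ↦ α(m) α'(m')`. -/
def evalMul (ι : N →ₐ[k] M) (m m' : M) : A ι ⊗[k] A ι →ₗ[k] M :=
  LinearMap.mul' k M ∘ₗ TensorProduct.map
    (LinearMap.applyₗ m ∘ₗ (A ι).val.toLinearMap) (LinearMap.applyₗ m' ∘ₗ (A ι).val.toLinearMap)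

@[simp] theorem evalMul_tmul (m m' : M) (α α' : A ι) :
    evalMul ι m m' (α ⊗ₜ α') = α.1 m * α'.1 m' := by
  simp [evalMul]

theorem RightQuasibasis.evalMul_comul (Q : RightQuasibasis ι) (α : A ι) (m m' : M) :
    evalMul ι m m' (Q.comul α) = α.1 (m * m') := by
  rw [Q.comul_apply, map_sum, ← Q.sum_mul_conjEnd]
  exact Finset.sum_congr rfl fun i _ => evalMul_tmul _ _ _ _

/-- If `X` and `Y` describe the action of `α` and `α'` on products, then `X Y` describes that of
`α α'`. -/
theorem evalMul_mul {X Y : A ι ⊗[k] A ι} {α α' : A ι}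
    (hX : ∀ m m', evalMul ι m m' X = α.1 (m * m'))
    (hY : ∀ m m', evalMul ι m m' Y = α'.1 (m * m')) (m m' : M) :
    evalMul ι m m' (X * Y) = (α * α').1 (m * m') := by
  obtain ⟨r, u, v, rfl⟩ := TensorProduct.exists_sum_tmul_eq Y
  have h : ∀ X : A ι ⊗[k] A ι, ∀ β β' : A ι,
      evalMul ι m m' (X * β ⊗ₜ β') = evalMul ι (β.1 m) (β'.1 m') X := fun X β β' => by
    induction X with
    | zero => simp
    | add s t hs ht => simp only [add_mul, map_add, hs, ht]
    | tmul x y => simp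
  simp only [map_sum, evalMul_tmul] at hY
  simp only [Finset.mul_sum, map_sum, h, hX]
  rw [← map_sum, hY]
  rfl

theorem algebraMap_inj [Nontrivial M] {c d : k} : algebraMap k M c = algebraMap k M d ↔ c = d :=
  (algebraMap k M).injective.eq_iff

namespace ScalarPart

variable (π : ScalarPart ι)

/-- An element of `A ⊗ A` is determined by the operator `(m, m') ↦ α(m) α'(m')`. -/
theorem ext_of_evalMul (π : ScalarPart ι) (Q : RightQuasibasis ι) {s t : A ι ⊗[k] A ι}
    (h : ∀ m m', evalMul ι m m' s = evalMul ι m m' t) : s = t := by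
  refine ext_of_evalTensor (V := A ι) (W := A ι) (φ := π.form.flip) (ψ := π.form.flip)
    (π.form_left_separating Q) (π.form_left_separating Q) fun b b' => ?_
  obtain ⟨r, u, v, rfl⟩ := TensorProduct.exists_sum_tmul_eq s
  obtain ⟨r', u', v', rfl⟩ := TensorProduct.exists_sum_tmul_eq t
  simp only [map_sum, evalMul_tmul] at h
  have h1 : ∀ m' (T : TensorSq ι), ∑ j, mu ι (mapSnd ι (u j) T) * (v j).1 m' =
      ∑ j, mu ι (mapSnd ι (u' j) T) * (v' j).1 m' := fun m' T => by
    induction T using induction with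
    | h0 => simp
    | ht x y =>
      simp only [mapSnd_tmul, mu_tmul, mul_assoc]
      rw [← Finset.mul_sum, h, Finset.mul_sum]
    | ha s t hs ht => simp only [map_add, add_mul, Finset.sum_add_distrib, hs, ht]
  have h2 : ∑ j, π.form (u j) b • v j = ∑ j, π.form (u' j) b • v' j :=
    Subtype.ext <| LinearMap.ext fun m' => by
      have h3 := h1 m' b.1
      have h4 : ∀ α : A ι, mu ι (mapSnd ι α b.1) = algebraMap k M (π.form α b) := fun α =>
        (π.algebraMap_form α b).symm
      simp only [h4, ← Algebra.smul_def] at h3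
      simp only [AddSubmonoidClass.coe_finsetSum, LinearMap.sum_apply]
      exact h3
  have h3 := congrArg (fun α => π.form α b') h2
  simpa using h3

theorem isComulFor_A [Nontrivial M] (Q : RightQuasibasis ι) :
    IsComulFor (H := A ι) (K := B ι) π.form Q.comul := by
  intro α b b'
  rw [Q.comul_apply, map_sum, ← algebraMap_inj (M := M), algebraMap_form, pairing_mul_right,
    ← algebraMap_form, algebraMap_inj]
  simp only [evalTensor_tmul, LinearMap.flip_apply]
  -- expand `b` in the `cᵢ`, on which the right side is written
  conv_lhs => rw [← π.sum_form_smul_c Q b]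
  change π.form (conjEndₗ ι (∑ i, π.form (Q.γ i) b • Q.c i) α) b' = _
  simp only [map_sum, map_smul, LinearMap.sum_apply, LinearMap.smul_apply, smul_eq_mul]
  rfl

theorem form_mul_left [Nontrivial M] (α α' : A ι) (b : B ι) :
    π.form (α * α') b = π.form α (applySnd α' b) := by
  rw [← algebraMap_inj (M := M), algebraMap_form, algebraMap_form, pairing_mul_left]

theorem form_applyFst [Nontrivial M] (α α' : A ι) (b : B ι) :
    π.form α' (applyFst ι α b) = π.twistedForm α (applySnd α' b) := by
  rw [← algebraMap_inj (M := M), algebraMap_form, algebraMap_twistedForm]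
  exact congrArg (mu ι) (mapFst_mapSnd α α' b.1).symm

theorem isComulFor_B [Nontrivial M] (Q : LeftQuasibasis ι) :
    IsComulFor (H := B ι) (K := A ι) π.form.flip Q.comul := by
  intro b α α'
  rw [Q.comul_apply, map_sum, LinearMap.flip_apply, form_mul_left]
  simp only [evalTensor_tmul, LinearMap.flip_flip, form_applyFst]
  -- `βᵢ(b¹) α'(b²)` is the `bᵢ`-coefficient of `b¹ ⊗ α'(b²)`
  conv_lhs => rw [← π.sum_twistedForm_smul_b Q (applySnd α' b)]
  simp [mul_comm]

theorem form_one_one [Nontrivial M] : π.form (1 : A ι) (1 : B ι) = 1 := by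
  rw [← algebraMap_inj (M := M), algebraMap_form_one, RingHom.map_one]
  rfl

theorem form_mul_one [Nontrivial M] (α α' : A ι) :
    π.form (α * α') (1 : B ι) = π.form α (1 : B ι) * π.form α' (1 : B ι) := by
  rw [← algebraMap_inj (M := M), RingHom.map_mul, algebraMap_form_one, algebraMap_form_one]
  change α.1 (α'.1 1) = _
  rw [← π.algebraMap_form_one α', ← Algebra.commutes, ← Algebra.smul_def,
    Algebra.algebraMap_eq_smul_one, map_smul]

theorem form_linearMap (c : k) (b : B ι) :
    π.form (Algebra.linearMap k (A ι) c) b = c * π.form (1 : A ι) b := by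
  rw [Algebra.linearMap_apply, Algebra.algebraMap_eq_smul_one, map_smul, LinearMap.smul_apply,
    smul_eq_mul]

end ScalarPart

/-- The data from which the Hopf algebras `A` and `B` are built: quasibases on both sides, and the
triviality of the centralizer in the form of a scalar part. -/
structure HopfData (ι : N →ₐ[k] M) where
  π : ScalarPart ι
  right : RightQuasibasis ι
  left : LeftQuasibasis ι

namespace HopfData

variable (D : HopfData ι)

theorem comul_one : D.right.comul 1 = 1 := by
  refine D.π.ext_of_evalMul D.right fun m m' => ?_
  rw [D.right.evalMul_comul, Algebra.TensorProduct.one_def, evalMul_tmul]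
  rfl

theorem comul_mul (α α' : A ι) :
    D.right.comul (α * α') = D.right.comul α * D.right.comul α' := by
  refine D.π.ext_of_evalMul D.right fun m m' => ?_
  rw [D.right.evalMul_comul, evalMul_mul (D.right.evalMul_comul α) (D.right.evalMul_comul α')]

/-- The antipode of `A`, determined by `⟨S(α), b⟩ = α(b¹) b²`. -/
def antipodeA : A ι →ₗ[k] A ι :=
  haveI := D.π.isPerfPair_form D.right
  (LinearMap.toPerfPair (R := k) (M := A ι) (N := B ι) D.π.form).symm.toLinearMap ∘ₗ
    D.π.twistedForm

/-- The antipode of `B`, determined by `⟨α, S(b)⟩ = α(b¹) b²`. -/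
def antipodeB : B ι →ₗ[k] B ι :=
  haveI := D.π.isPerfPair_form D.right
  (LinearMap.toPerfPair (R := k) (M := B ι) (N := A ι) D.π.form.flip).symm.toLinearMap ∘ₗ
    D.π.twistedForm.flip

theorem form_antipodeA (α : A ι) (b : B ι) :
    D.π.form (D.antipodeA α) b = D.π.twistedForm α b := by
  have := D.π.isPerfPair_form D.right
  exact LinearMap.congr_fun (LinearMap.apply_symm_toPerfPair_self (R := k) (M := A ι) (N := B ι)
    D.π.form (D.π.twistedForm α)) b

theorem form_antipodeB (α : A ι) (b : B ι) :
    D.π.form α (D.antipodeB b) = D.π.twistedForm α b := by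
  have := D.π.isPerfPair_form D.right
  exact LinearMap.congr_fun (LinearMap.apply_symm_toPerfPair_self (R := k) (M := B ι) (N := A ι)
    D.π.form.flip (D.π.twistedForm.flip b)) α

variable [Nontrivial M]

/-- `S(α₁) α₂ = ε(α) 1`: both sides pair with `b` to `α₁(b¹) α₂(b²) = α(b¹ b²)`. -/
theorem antipodeA_rTensor :
    LinearMap.mul' k (A ι) ∘ₗ D.antipodeA.rTensor (A ι) ∘ₗ D.right.comul =
      Algebra.linearMap k (A ι) ∘ₗ D.π.form.flip 1 := by
  refine LinearMap.ext fun α => ?_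
  rw [← sub_eq_zero]
  refine D.π.form_left_separating D.right _ fun b => ?_
  rw [map_sub, LinearMap.sub_apply, sub_eq_zero, ← algebraMap_inj (M := M)]
  simp only [LinearMap.comp_apply, D.right.comul_apply, map_sum, LinearMap.rTensor_tmul,
    LinearMap.mul'_apply, LinearMap.sum_apply, ScalarPart.form_mul_left, form_antipodeA,
    ScalarPart.algebraMap_twistedForm]
  have h : ∀ t, ∑ i, mu ι (mapFst ι (D.right.γ i)
      (mapSnd ι (conjEnd ι (D.right.c i) α) t)) = α.1 (mu ι t) := fun t => by
    induction t using induction with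
    | h0 => simp
    | ht m m' =>
      simp only [mapSnd_tmul, mapFst_tmul, mu_tmul]
      exact D.right.sum_mul_conjEnd α m m'
    | ha s t hs ht => simp only [map_add, Finset.sum_add_distrib, hs, ht]
  refine (h b.1).trans ?_
  rw [ScalarPart.form_linearMap, RingHom.map_mul, ← D.π.algebraMap_one_form, LinearMap.flip_apply,
    D.π.algebraMap_form_one, Algebra.algebraMap_eq_smul_one, map_smul, mul_smul_comm, mul_one]

/-- `α₁ S(α₂) = ε(α) 1`: pairing with `b` gives `α₂(⟨α₁, b₁⟩ b₂¹) b₂²`, which is computed with the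
quasibases that express `Δ(α)` and `Δ(b)`. -/
theorem antipodeA_lTensor :
    LinearMap.mul' k (A ι) ∘ₗ D.antipodeA.lTensor (A ι) ∘ₗ D.right.comul =
      Algebra.linearMap k (A ι) ∘ₗ D.π.form.flip 1 := by
  refine LinearMap.ext fun α => ?_
  rw [← sub_eq_zero]
  refine D.π.form_left_separating D.right _ fun b => ?_
  rw [map_sub, LinearMap.sub_apply, sub_eq_zero]
  have hB : ∀ α α', D.π.form (α * α') b =
      ∑ j, D.π.form α (D.left.b j) * D.π.form α' (applyFst ι (D.left.β j) b) := fun α α' => by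
    have := D.π.isComulFor_B D.left b α α'
    rw [D.left.comul_apply, map_sum] at this
    exact this
  simp only [LinearMap.comp_apply, D.right.comul_apply, map_sum, LinearMap.lTensor_tmul,
    LinearMap.mul'_apply, LinearMap.sum_apply, hB, form_antipodeA]
  rw [Finset.sum_comm]
  have h1 : ∀ j, ∑ i, D.π.form (D.right.γ i) (D.left.b j) •
      conjEnd ι (D.right.c i) α = conjEnd ι (D.left.b j) α := fun j => by
    have h2 := congrArg (fun b => conjEndₗ ι b α) (D.π.sum_form_smul_c D.right (D.left.b j))
    simp only [map_sum, map_smul, LinearMap.sum_apply, LinearMap.smul_apply] at h2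
    exact h2
  have h3 : ∀ j, ∑ i, D.π.form (D.right.γ i) (D.left.b j) *
      D.π.twistedForm (conjEnd ι (D.right.c i) α) (applyFst ι (D.left.β j) b) =
      D.π.twistedForm (conjEnd ι (D.left.b j) α) (applyFst ι (D.left.β j) b) := fun j => by
    rw [← h1 j]
    simp only [map_sum, map_smul, LinearMap.sum_apply, LinearMap.smul_apply, smul_eq_mul]
  simp only [h3]
  rw [← algebraMap_inj (M := M), map_sum]
  simp only [ScalarPart.algebraMap_twistedForm]
  have h4 : ∀ t, ∑ j, mu ι (mapFst ι (conjEnd ι (D.left.b j) α) (mapFst ι (D.left.β j) t)) =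
      D.π.form α 1 • mu ι t := fun t => by
    induction t using induction with
    | h0 => simp
    | ht m m' =>
      simp only [mapFst_tmul, mu_tmul]
      rw [← Finset.sum_mul, D.left.sum_conjEnd, ← D.π.algebraMap_form_one,
        ← Algebra.commutes, ← Algebra.smul_def, smul_mul_assoc]
    | ha s t hs ht => simp only [map_add, Finset.sum_add_distrib, hs, ht, smul_add]
  refine (h4 b.1).trans ?_
  rw [ScalarPart.form_linearMap, RingHom.map_mul, D.π.algebraMap_one_form, ← Algebra.smul_def]
  rfl

/-- The Hopf algebra structure of `A`. -/
def hopfA : HopfStructure k (A ι) where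
  toCoalgebra := coalgebraOfPairing (H := A ι) (K := B ι) (D.π.form_left_separating D.right)
    D.right.comul (D.π.isComulFor_A D.right)
  counit_one := D.π.form_one_one
  counit_mul := D.π.form_mul_one
  comul_one := D.comul_one
  comul_mul := D.comul_mul
  antipode := D.antipodeA
  mul_antipode_rTensor_comul := D.antipodeA_rTensor
  mul_antipode_lTensor_comul := D.antipodeA_lTensor

/-- The Hopf algebra structure of `B`, the dual of the one of `A`. -/
def hopfB : HopfStructure k (B ι) where
  toCoalgebra := coalgebraOfPairing (H := B ι) (K := A ι) (D.π.form_right_separating D.right)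
    D.left.comul (D.π.isComulFor_B D.left)
  counit_one := D.π.form_one_one
  counit_mul b b' := by
    have h := D.π.isComulFor_A D.right 1 b b'
    rw [D.comul_one, Algebra.TensorProduct.one_def, evalTensor_tmul] at h
    exact h
  comul_one := by
    refine ext_of_evalTensor (V := B ι) (W := B ι) (φ := D.π.form) (ψ := D.π.form)
      (D.π.form_right_separating D.right) (D.π.form_right_separating D.right) fun α α' => ?_
    rw [Algebra.TensorProduct.one_def, evalTensor_tmul, ← D.π.form_mul_one]
    exact (D.π.isComulFor_B D.left 1 α α').symm
  comul_mul := IsComulFor.comul_mul (H := A ι) (K := B ι) (D.π.isComulFor_A D.right)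
    (D.π.isComulFor_B D.left) (D.π.form_right_separating D.right) D.comul_mul
  antipode := D.antipodeB
  mul_antipode_rTensor_comul := IsComulFor.antipode_rTensor (H := A ι) (K := B ι)
    (D.π.isComulFor_A D.right) (D.π.isComulFor_B D.left) (D.π.form_right_separating D.right)
    (fun α b => (D.form_antipodeA α b).trans (D.form_antipodeB α b).symm) D.antipodeA_rTensor
  mul_antipode_lTensor_comul := IsComulFor.antipode_lTensor (H := A ι) (K := B ι)
    (D.π.isComulFor_A D.right) (D.π.isComulFor_B D.left) (D.π.form_right_separating D.right)
    (fun α b => (D.form_antipodeA α b).trans (D.form_antipodeB α b).symm) D.antipodeA_lTensor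

theorem isDualPairing : IsDualPairing D.hopfA D.hopfB D.π.form where
  perfect := D.π.isPerfPair_form D.right
  mul_left α α' b := D.π.isComulFor_B D.left b α α'
  mul_right := D.π.isComulFor_A D.right
  one_left _ := rfl
  one_right _ := rfl
  antipode α b := (D.form_antipodeA α b).trans (D.form_antipodeB α b).symm

/-- Two transposes of the same product agree, so `Δ` does not depend on the quasibasis. -/
theorem isCanonicalA_hopfA : IsCanonicalA D.hopfA where
  comul_eq Q α := by
    rw [← Q.comul_apply]
    refine ext_of_evalTensor (V := A ι) (W := A ι) (φ := D.π.form.flip) (ψ := D.π.form.flip)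
      (D.π.form_left_separating D.right) (D.π.form_left_separating D.right) fun b b' => ?_
    exact (D.π.isComulFor_A D.right α b b').symm.trans (D.π.isComulFor_A Q α b b')
  counit_eq := D.π.algebraMap_form_one

theorem isCanonicalB_hopfB : IsCanonicalB D.hopfB where
  comul_eq Q b := by
    rw [← Q.comul_apply]
    refine ext_of_evalTensor (V := B ι) (W := B ι) (φ := D.π.form) (ψ := D.π.form)
      (D.π.form_right_separating D.right) (D.π.form_right_separating D.right) fun α α' => ?_
    exact (D.π.isComulFor_B D.left b α α').symm.trans (D.π.isComulFor_B Q b α α')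
  counit_eq := D.π.algebraMap_one_form

end HopfData

end HopfAB

/-! ### Integrals of `A` and `B`, and semisimplicity -/

namespace FrobeniusSystem

section Contract

variable {k : Type u} {N : Type v} {M : Type w} [CommRing k] [Ring N] [Ring M]
  [Algebra k N] [Algebra k M] {ι : N →ₐ[k] M} (F : FrobeniusSystem ι)

theorem contract_lact (m m' : M) (t : TensorSq ι) :
    F.contract m (lact ι m' t) = F.contract (m * m') t := by
  induction t using induction with
  | h0 => simp
  | ht a b => simp [mul_assoc]
  | ha s t hs ht => simp only [map_add, hs, ht]

theorem contract_ract (m m' : M) (t : TensorSq ι) :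
    F.contract m (ract ι m' t) = F.contract m t * m' := by
  induction t using induction with
  | h0 => simp
  | ht a b => simp [mul_assoc]
  | ha s t hs ht => simp only [map_add, hs, ht, add_mul]

theorem contract_mapSnd (α : A ι) (m : M) (t : TensorSq ι) :
    F.contract m (mapSnd ι α t) = α.1 (F.contract m t) := by
  induction t using induction with
  | h0 => simp
  | ht a b => simp [(α.2 _ b).1]
  | ha s t hs ht => simp only [map_add, hs, ht]

end Contract

section Central

variable {k : Type u} {N : Type v} {M : Type w} [Field k] [Ring N] [Ring M]
  [Algebra k N] [Algebra k M] {ι : N →ₐ[k] M} (F : FrobeniusSystem ι)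

theorem contract_one_oneAux : F.contract 1 F.oneAux = 1 := by
  have h := F.sum_right 1
  simpa [oneAux] using h

/-- If the centralizer of `N` is trivial, then the `M`-central elements of `M ⊗_N M` are the
multiples of `∑ xᵢ ⊗ yᵢ`: they correspond to the endomorphisms of `_M M_N`. -/
theorem eq_smul_oneAux_of_central (π : ScalarPart ι) (s : TensorSq ι)
    (hs : ∀ m, lact ι m s = ract ι m s) : ∃ c : k, s = c • F.oneAux := by
  have hz : algebraMap k M (π.toFun (F.contract 1 s)) = F.contract 1 s :=
    π.algebraMap_toFun _ fun n => by
      rw [← F.contract_mul, mul_one, ← F.contract_ract, ← hs, F.contract_lact, one_mul]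
  have hc : ∀ m, F.contract m s = π.toFun (F.contract 1 s) • m := fun m => by
    rw [Algebra.smul_def, hz, ← F.contract_ract, ← hs, F.contract_lact, one_mul]
  refine ⟨π.toFun (F.contract 1 s), ?_⟩
  generalize π.toFun (F.contract 1 s) = c at hc
  rw [← F.one_mulAux s, oneAux]
  simp only [map_sum, LinearMap.sum_apply, mulAux_tmul, hc, map_smul, Finset.smul_sum]

/-- For a separable extension with trivial centralizer, `μ(∑ xᵢ ⊗ yᵢ)` is an invertible scalar. -/
theorem exists_smul_mu_oneAux (π : ScalarPart ι) (h : IsSeparableExt ι) :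
    ∃ c : k, c • mu ι F.oneAux = 1 := by
  obtain ⟨σ, h1, h2, h3⟩ := h
  obtain ⟨c, hc⟩ := F.eq_smul_oneAux_of_central π (σ 1) fun m => by
    rw [← h1, ← h2, mul_one, one_mul]
  exact ⟨c, by rw [← map_smul, ← hc, h3]⟩

/-- `d · ∑ xᵢ ⊗ yᵢ = ε(d) ∑ xᵢ ⊗ yᵢ` in `B`, that is, `∑ xᵢ d¹ ⊗ d² yᵢ = d¹ d² ∑ xᵢ ⊗ yᵢ`. The
left side is `M`-central, hence a multiple of `∑ xᵢ ⊗ yᵢ`, and `μ` detects the factor. -/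
theorem sandwich_oneAux [Nontrivial M] (π : ScalarPart ι) (h : IsSeparableExt ι) (d : B ι) :
    sandwich ι d F.oneAux = π.form 1 d • F.oneAux := by
  obtain ⟨c, hc⟩ := F.exists_smul_mu_oneAux π h
  obtain ⟨e, he⟩ := F.eq_smul_oneAux_of_central π (sandwich ι d F.oneAux) fun m => by
    rw [← sandwich_lact, ← sandwich_ract, lact_oneAux]
  have hmu : ∀ t, mu ι (sandwich ι d t) = π.form 1 d • mu ι t := fun t => by
    induction t using induction with
    | h0 => simp
    | ht a b =>
      rw [sandwich_tmul, mu_lact, mu_ract, ← π.algebraMap_one_form, ← Algebra.smul_def,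
        mul_smul_comm, mu_tmul]
    | ha s t hs ht => simp only [map_add, hs, ht, smul_add]
  have h1 := congrArg (fun t => c • mu ι t) he
  simp only [hmu, map_smul] at h1
  rw [smul_comm c, smul_comm c, hc, ← Algebra.algebraMap_eq_smul_one,
    ← Algebra.algebraMap_eq_smul_one, algebraMap_inj] at h1
  rw [he, h1]

/-- `∑ xᵢ ⊗ yᵢ` as an element of `B`. -/
def oneB : B ι := ⟨F.oneAux, fun n => F.lact_oneAux (ι n)⟩

/-- The Frobenius homomorphism as an element of `A`. -/
def endE : A ι :=
  ⟨ι.toLinearMap ∘ₗ F.E, fun n m => by simp [F.E_left, F.E_right]⟩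

theorem endE_apply (m : M) : F.endE.1 m = ι (F.E m) := rfl

theorem mul_endE (π : ScalarPart ι) (α : A ι) : α * F.endE = π.form α 1 • F.endE := by
  refine Subtype.ext <| LinearMap.ext fun m => ?_
  change α.1 (ι (F.E m)) = π.form α 1 • ι (F.E m)
  have h := (α.2 (F.E m) 1).1
  rw [mul_one] at h
  rw [h, ← π.algebraMap_form_one, ← Algebra.commutes, ← Algebra.smul_def]

/-- For a split extension with trivial centralizer, `E(1) ≠ 0`: the bimodule retraction onto `N` is
of the form `E(d -)` with `d` in the centralizer, so it is a multiple of `E`. -/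
theorem form_endE_ne_zero [Nontrivial M] (π : ScalarPart ι) (h : IsSplitExt ι) :
    π.form F.endE 1 ≠ 0 := by
  obtain ⟨j, p, h1, h2, h3, h4, h5⟩ := h
  -- the embedding `j : N → M` is itself a multiple of `ι`
  have hu := π.algebraMap_toFun (j 1) fun n => by rw [← h1, ← h2, mul_one, one_mul]
  have hp : ∀ m, p m = F.E ((∑ i, ι (p (F.x i)) * F.y i) * m) := fun m => by
    conv_lhs => rw [← F.sum_left m]
    simp only [map_sum, h4, Finset.sum_mul, mul_assoc, F.E_left]
  -- `d = ∑ p(xᵢ) yᵢ` commutes with `n`, because `E(n d m) = n p(m) = p(n m) = E(d n m)`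
  have hd := π.algebraMap_toFun (∑ i, ι (p (F.x i)) * F.y i) fun n => by
    have h6 : ∀ m, F.E ((ι n * ∑ i, ι (p (F.x i)) * F.y i) * m) =
        F.E (((∑ i, ι (p (F.x i)) * F.y i) * ι n) * m) := fun m => by
      rw [mul_assoc, F.E_left, mul_assoc, ← hp, ← hp, h3]
    rw [← F.sum_right (ι n * _), ← F.sum_right (_ * ι n)]
    simp only [h6]
  have h7 := h5 1
  rw [hp, ← hd, ← hu, ← Algebra.smul_def, Algebra.algebraMap_eq_smul_one, map_smul, map_smul] at h7
  intro h0
  have h8 := π.algebraMap_form_one F.endE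
  rw [h0, map_zero, endE_apply] at h8
  have h9 := congrArg ι h7
  rw [map_smul, map_smul, ← h8, smul_zero, smul_zero, map_one] at h9
  exact zero_ne_one h9

end Central

end FrobeniusSystem

namespace HopfData

variable {k : Type u} {N : Type v} {M : Type w} [Field k] [Ring N] [Ring M] [Nontrivial M]
  [Algebra k N] [Algebra k M] {ι : N →ₐ[k] M}

theorem isSemisimpleRing_A (D : HopfData ι) (F : FrobeniusSystem ι) (h : IsSplitExt ι) :
    IsSemisimpleRing (A ι) := by
  have h0 := F.form_endE_ne_zero D.π h
  refine D.hopfA.isSemisimpleRing ((D.π.form F.endE 1)⁻¹ • F.endE) (fun α => ?_) ?_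
  · change α * _ = D.π.form α 1 • _
    rw [mul_smul_comm, F.mul_endE D.π, smul_comm]
  · change D.π.form _ 1 = 1
    rw [map_smul, LinearMap.smul_apply, smul_eq_mul, inv_mul_cancel₀ h0]

theorem isSemisimpleRing_B (D : HopfData ι) (F : FrobeniusSystem ι) (h : IsSeparableExt ι) :
    IsSemisimpleRing (B ι) := by
  obtain ⟨c, hc⟩ := F.exists_smul_mu_oneAux D.π h
  refine D.hopfB.isSemisimpleRing (c • F.oneB) (fun d => ?_) ?_
  · change d * _ = D.π.form 1 d • _
    rw [mul_smul_comm, smul_comm]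
    exact congrArg (c • ·) (Subtype.ext (F.sandwich_oneAux D.π h d))
  · change D.π.form 1 _ = 1
    rw [← algebraMap_inj (M := M), D.π.algebraMap_one_form, RingHom.map_one, ← hc]
    exact map_smul (mu ι) c F.oneAux

end HopfData

/-! ### The centralizers in the Jones tower -/

namespace FrobeniusSystem

variable {k : Type u} {N : Type v} {M : Type w} [CommRing k] [Ring N] [Ring M]
  [Algebra k N] [Algebra k M] {ι : N →ₐ[k] M} (F : FrobeniusSystem ι)

theorem mulAux_ract_left (m : M) (s t : TensorSq ι) :
    F.mulAux (ract ι m s) t = F.mulAux s (lact ι m t) := by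
  have h : ∀ b, F.contract (b * m) t = F.contract b (lact ι m t) := fun b => by
    induction t using induction with
    | h0 => simp
    | ht c d => simp [mul_assoc]
    | ha s t hs ht => simp only [map_add, hs, ht]
  induction s using induction with
  | h0 => simp
  | ht a b => simp [h]
  | ha s s' hs hs' => simp only [map_add, LinearMap.add_apply, hs, hs']

/-- The action `(a ⊗ b) · m = a E(b m)` of `M₁` on `M`. -/
def act (t : TensorSq ι) : Module.End k M := mu ι ∘ₗ F.mulAux t ∘ₗ (tmul ι).flip 1

theorem act_apply (t : TensorSq ι) (m : M) : F.act t m = mu ι (F.mulAux t (tmul ι m 1)) := rfl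

/-- `M ⊗ 1` is a left ideal of `M₁`, on which `M₁` acts as on `M`. -/
theorem mulAux_tmul_one (t : TensorSq ι) (m : M) :
    F.mulAux t (tmul ι m 1) = tmul ι (F.act t m) 1 := by
  rw [act_apply]
  induction t using induction with
  | h0 => simp
  | ht a b => rw [mulAux_tmul_tmul, mu_tmul, mul_one]
  | ha s t hs ht =>
    rw [map_add, LinearMap.add_apply, map_add, map_add, LinearMap.add_apply, ← hs, ← ht]

theorem mulAux_tmul_right (t : TensorSq ι) (m m' : M) :
    F.mulAux t (tmul ι m m') = tmul ι (F.act t m) m' := by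
  have h := ract_tmul ι m' m 1
  rw [one_mul] at h
  rw [← h, mulAux_ract, mulAux_tmul_one, ract_tmul, one_mul]

theorem act_mulAux (s t : TensorSq ι) : F.act (F.mulAux s t) = F.act s * F.act t := by
  ext m
  rw [act_apply, mulAux_assoc, mulAux_tmul_one]
  rfl

theorem mem_Ahat {t : TensorSq ι} :
    F.toBasic t ∈ F.Ahat ↔ ∀ n, lact ι (ι n) t = ract ι (ι n) t := by
  rw [Ahat, Subalgebra.mem_centralizer_iff]
  simp only [Set.forall_mem_range, incl_mul, mul_incl, F.toBasic.injective.eq_iff]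

theorem act_mem {t : TensorSq ι} (ht : ∀ n, lact ι (ι n) t = ract ι (ι n) t) :
    F.act t ∈ A ι := by
  refine fun n m => ⟨?_, ?_⟩
  · rw [act_apply, ← lact_tmul, ← mulAux_ract_left, ← ht, mulAux_lact, mu_lact, act_apply]
  · have h : tmul ι (m * ι n) 1 = ract ι (ι n) (tmul ι m 1) := by
      rw [ract_tmul, tmul_balanced, mul_one, one_mul]
    rw [act_apply, h, mulAux_ract, mu_ract, act_apply]

theorem act_mapFst_oneAux (α : A ι) : F.act (mapFst ι α F.oneAux) = α.1 := by
  ext m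
  rw [act_apply]
  simp only [oneAux, map_sum, mapFst_tmul, LinearMap.sum_apply, mulAux_tmul_tmul, mu_tmul, mul_one]
  conv_rhs => rw [← F.sum_left m, map_sum]
  exact Finset.sum_congr rfl fun i _ => ((α.2 _ _).2).symm

/-- `Â = M₁^N` is `A = End(_N M_N)`: the algebra `M₁` acts on `M` as `End(M_N)`, and the inverse is
`α ↦ ∑ α(xᵢ) ⊗ yᵢ`. -/
def AhatEquiv : F.Ahat ≃ₐ[k] A ι where
  toFun a := ⟨F.act (F.toBasic.symm a.1), F.act_mem (F.mem_Ahat.1 a.2)⟩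
  invFun α := ⟨F.toBasic (mapFst ι α F.oneAux), F.mem_Ahat.2
    (applyFst ι α ⟨F.oneAux, fun n => F.lact_oneAux (ι n)⟩).2⟩
  left_inv a := Subtype.ext <| by
    change F.toBasic (mapFst ι _ (∑ i, tmul ι (F.x i) (F.y i))) = F.toBasic (F.toBasic.symm a.1)
    simp only [map_sum, mapFst_tmul, ← F.mulAux_tmul_right]
    simp only [← map_sum]
    exact congrArg F.toBasic (F.mulAux_one _)
  right_inv α := Subtype.ext (F.act_mapFst_oneAux α)
  map_mul' a b := Subtype.ext (F.act_mulAux _ _)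
  map_add' a b := Subtype.ext <| LinearMap.ext fun m =>
    congrArg (mu ι) (LinearMap.map_add₂ F.mulAux a.1 b.1 _) |>.trans (map_add (mu ι) _ _)
  commutes' c := Subtype.ext <| LinearMap.ext fun m => by
    change mu ι (F.mulAux (c • F.oneAux) (tmul ι m 1)) = c • m
    rw [map_smul, LinearMap.smul_apply, one_mulAux, map_smul, mu_tmul, mul_one]

theorem AhatEquiv_apply_coe (a : F.Ahat) :
    (F.AhatEquiv a).1 = F.act (F.toBasic.symm a.1) := rfl

/-- `B = (M ⊗_N M)^N` is the algebra of bimodule endomorphisms of `_M (M ⊗_N M)_M`, where `b` acts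
by `m ⊗ m' ↦ m b m'`. -/
def sandwichEquiv : B ι ≃ₐ[k] A F.incl where
  toFun b := ⟨F.toBasic.toLinearMap ∘ₗ sandwich ι b ∘ₗ F.toBasic.symm.toLinearMap, fun m t => by
    obtain ⟨t, rfl⟩ := F.toBasic.surjective t
    rw [incl_mul, mul_incl]
    simp only [LinearMap.comp_apply, LinearEquiv.coe_coe, LinearEquiv.symm_apply_apply,
      sandwich_lact, sandwich_ract, incl_mul, mul_incl, and_self]⟩
  invFun f := ⟨F.toBasic.symm (f.1 F.jones), fun n => by
    refine F.toBasic.injective ?_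
    rw [← incl_mul, ← mul_incl, LinearEquiv.apply_symm_apply, ← (f.2 (ι n) _).1,
      ← (f.2 (ι n) _).2, jones, incl_mul, mul_incl, lact_tmul, ract_tmul]
    have h := tmul_balanced ι 1 n 1
    simp only [one_mul, mul_one] at h ⊢
    rw [h]⟩
  left_inv b := Subtype.ext <| by
    change sandwich ι b (tmul ι 1 1) = b.1
    rw [sandwich_tmul, ract_one, lact_one]
  right_inv f := Subtype.ext <| LinearMap.ext fun t => by
    obtain ⟨t, rfl⟩ := F.toBasic.surjective t
    simp only [LinearMap.comp_apply, LinearEquiv.coe_coe, LinearEquiv.symm_apply_apply]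
    induction t using induction with
    | h0 => simp
    | ht m m' =>
      rw [sandwich_tmul, ← incl_mul, ← mul_incl, LinearEquiv.apply_symm_apply, ← (f.2 m' _).2,
        ← (f.2 m _).1, jones, mul_incl, incl_mul, ract_tmul, lact_tmul, one_mul, mul_one]
    | ha s t hs ht => simp only [map_add, hs, ht]
  map_mul' b b' := Subtype.ext <| LinearMap.ext fun t => sandwich_mul ι b b' t
  map_add' b b' := Subtype.ext <| LinearMap.ext fun t => sandwich_add ι b b' t
  commutes' c := Subtype.ext <| LinearMap.ext fun t =>
    (sandwich_smul ι c 1 t).trans (congrArg (c • ·) (sandwich_one ι t))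

/-- `B̂ = M₂^M` is `B`: it is the algebra `Â` of the extension `M₁|M`, hence the endomorphism
algebra of `_M (M ⊗_N M)_M`. -/
def BhatEquiv : F.Bhat ≃ₐ[k] B ι :=
  (show F.Bhat ≃ₐ[k] A F.incl from F.next.AhatEquiv).trans F.sandwichEquiv.symm

theorem BhatEquiv_symm_apply_coe (d : B ι) :
    (F.BhatEquiv.symm d).1 =
      F.next.toBasic (mapFst F.incl (F.sandwichEquiv d) F.next.oneAux) := rfl

/-- The tower pairing, expressed through `A` and `B`: it is `∑ α(E(xⱼ d¹) d²) yⱼ`. -/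
theorem towerPairing_symm (a : F.Ahat) (d : B ι) :
    F.towerPairing a (F.BhatEquiv.symm d) =
      ∑ j, (F.AhatEquiv a).1 (F.contract (F.x j) d.1) * F.y j := by
  have h1 : F.next.incl a.1 * F.next.jones * F.next.incl F.jones =
      F.next.toBasic (tmul F.incl a.1 F.jones) := by
    rw [jones, incl_mul, mul_incl, lact_tmul, ract_tmul, mul_one, one_mul]
  have h2 : F.next.contract F.jones (mapFst F.incl (F.sandwichEquiv d) F.next.oneAux) =
      ∑ j, F.toBasic (tmul ι (F.contract (F.x j) d.1) (F.y j)) := by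
    -- the dual bases of `M₁|M` are `xⱼ ⊗ 1` and `1 ⊗ yⱼ`
    rw [oneAux, map_sum, map_sum]
    refine Finset.sum_congr rfl fun j _ => ?_
    rw [mapFst_tmul, contract_tmul]
    have h3 : F.next.E (F.jones * (F.sandwichEquiv d).1 (F.next.x j)) =
        F.contract (F.x j) d.1 := by
      change mu ι (F.mulAux (tmul ι 1 1) (sandwich ι d (tmul ι (F.x j) 1))) = _
      rw [sandwich_tmul, ract_one, mulAux_tmul, mu_tmul, one_mul]
      exact (F.contract_lact 1 _ _).trans (by rw [one_mul])
    rw [h3]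
    change F.incl _ * F.toBasic (tmul ι 1 (F.y j)) = _
    rw [incl_mul, lact_tmul, mul_one]
  rw [towerPairing, h1, BhatEquiv_symm_apply_coe, toBasic_mul, mulAux_tmul]
  change F.muBasic (mu F.incl (tmul F.incl a.1 (F.next.contract F.jones
    (mapFst F.incl (F.sandwichEquiv d) F.next.oneAux)))) = _
  rw [mu_tmul, h2, Finset.mul_sum, map_sum]
  refine Finset.sum_congr rfl fun j _ => ?_
  change mu ι (F.mulAux (F.toBasic.symm a.1) _) = _
  rw [AhatEquiv_apply_coe]
  exact (congrArg (mu ι) (F.mulAux_tmul_right _ _ _)).trans (mu_tmul ι _ _)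

end FrobeniusSystem

section

variable {k : Type u} {N : Type v} {M : Type w} [Field k] [Ring N] [Ring M] [Nontrivial M]
  [Algebra k N] [Algebra k M] {ι : N →ₐ[k] M}

/-- Under `Â ≅ A` and `B̂ ≅ B` the tower pairing is the canonical pairing. Applying `E ⊗ id` to
`∑ xⱼ d¹ ⊗ α(d²) yⱼ = d¹ α(d²) ∑ xⱼ ⊗ yⱼ` gives `∑ E(xⱼ d¹) α(d²) yⱼ = d¹ α(d²)`. -/
theorem FrobeniusSystem.towerPairing_eq (F : FrobeniusSystem ι) (π : ScalarPart ι)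
    (h : IsSeparableExt ι) (a : F.Ahat) (b : F.Bhat) :
    F.towerPairing a b = pairing ι (F.AhatEquiv a) (F.BhatEquiv b) := by
  obtain ⟨d, rfl⟩ := F.BhatEquiv.symm.surjective b
  rw [F.towerPairing_symm, AlgEquiv.apply_symm_apply]
  have h1 := congrArg (F.contract 1) (F.sandwich_oneAux π h (applySnd (F.AhatEquiv a) d))
  rw [map_smul, F.contract_one_oneAux, ← Algebra.algebraMap_eq_smul_one,
    π.algebraMap_one_form] at h1
  refine Eq.trans ?_ h1
  simp only [FrobeniusSystem.oneAux, map_sum, sandwich_tmul, F.contract_lact, F.contract_ract,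
    one_mul]
  refine Finset.sum_congr rfl fun j _ => ?_
  exact congrArg (· * F.y j) (F.contract_mapSnd _ _ _).symm

end

end DepthTwo

end

theorem mainTheorem10 {k : Type*} {N : Type*} {M : Type*} [Field k] [Ring N] [Ring M]
    [Nontrivial M] [Algebra k N] [Algebra k M] (ι : N →ₐ[k] M)
    (hR : Subalgebra.centralizer k (Set.range ι) = ⊥)
    (hbisep : DepthTwo.IsBiseparable ι) (hD2 : DepthTwo.IsDepthTwo ι)
    (F : DepthTwo.FrobeniusSystem ι) :
    ∃ (HA : DepthTwo.HopfStructure k (DepthTwo.A ι)) (HB : DepthTwo.HopfStructure k (DepthTwo.B ι))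
      (HAhat : DepthTwo.HopfStructure k F.Ahat) (HBhat : DepthTwo.HopfStructure k F.Bhat),
      DepthTwo.IsCanonicalA HA ∧ DepthTwo.IsCanonicalB HB ∧
      Module.Finite k (DepthTwo.A ι) ∧ Module.Finite k (DepthTwo.B ι) ∧
      DepthTwo.AreDual HA HB ∧
      IsSemisimpleRing (DepthTwo.A ι) ∧ IsSemisimpleRing (DepthTwo.B ι) ∧
      DepthTwo.AreTowerHopf HAhat HBhat ∧
      HA.Isomorphic HAhat ∧ HB.Isomorphic HBhat := by
  obtain ⟨π⟩ := DepthTwo.exists_scalarPart hR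
  obtain ⟨QL⟩ := hD2.1.exists_quasibasis
  obtain ⟨QR⟩ := hD2.2.exists_quasibasis
  let D : DepthTwo.HopfData ι := ⟨π, QR, QL⟩
  refine ⟨D.hopfA, D.hopfB, D.hopfA.transport F.AhatEquiv.symm,
    D.hopfB.transport F.BhatEquiv.symm, D.isCanonicalA_hopfA, D.isCanonicalB_hopfB,
    π.finite_A QR, π.finite_B QR, ⟨π.form, π.algebraMap_form, D.isDualPairing⟩,
    D.isSemisimpleRing_A F hbisep.split, D.isSemisimpleRing_B F hbisep.separable,
    ⟨_, fun a b => ?_, D.isDualPairing.transport F.AhatEquiv.symm F.BhatEquiv.symm⟩,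
    D.hopfA.isomorphic_transport _, D.hopfB.isomorphic_transport _⟩
  rw [F.towerPairing_eq π hbisep.separable]
  exact π.algebraMap_form (F.AhatEquiv a) (F.BhatEquiv b)
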